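/- A *convex polyhedron* is a bounded intersection of finitely many closed half-spaces of $\mathbb{R}^3$ with non-empty interior. It is *$k$-equiprojective* if its orthogonal projection along every direction that is not parallel to one of its (two-dimensional) faces is a convex $k$-gon. A *$k$-gonal prism* is the set $B+[0,u]$, where $B$ is a planar convex $k$-gon in $\mathbb{R}^3$ and $u$ is a vector not parallel to the plane of $B$; its *lateral faces* are the parallelograms $e+[0,u]$ with $e$ an edge of $B$. Let $P_1$ be a $k_1$-gonal prism and $P_2$ a $k_2$-gonal prism such that $P_1\cap P_2=F$ is a lateral face of both $P_1$ and $P_2$. Suppose that $P=P_1\cup P_2$ is convex and that each of the four vertices of $F$ is a vertex (extreme point) of $P$; such a $P$ is called an *equiprojective bi-prism*. **Theorem.** Every equiprojective bi-prism $P=P_1\cup P_2$ obtained from a $k_1$-gonal prism and a $k_2$-gonal prism is a $(k_1+k_2)$-equiprojective convex polyhedron. -/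

import Mathlib

open scoped Pointwise

/-- Euclidean three-space. -/
abbrev E3 : Type := EuclideanSpace ℝ (Fin 3)

/-- A (planar, non-degenerate) convex `k`-gon in space: the convex hull of finitely many points
which spans a plane and has exactly `k` vertices. -/
def IsConvexPolygon (k : ℕ) (Q : Set E3) : Prop :=
  (∃ s : Set E3, s.Finite ∧ Q = convexHull ℝ s) ∧
    Module.finrank ℝ (vectorSpan ℝ Q) = 2 ∧
    (Q.extremePoints ℝ).ncard = k

/-- A (three-dimensional, bounded) convex polyhedron: a bounded intersection of finitely many
closed half-spaces `{x | ⟪a, x⟫ ≤ b}`, `a ≠ 0`, with non-empty interior. -/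
def IsConvexPolyhedron (P : Set E3) : Prop :=
  Bornology.IsBounded P ∧ (interior P).Nonempty ∧
    ∃ H : Set (E3 × ℝ), H.Finite ∧ (∀ h ∈ H, h.1 ≠ 0) ∧
      P = {x : E3 | ∀ h ∈ H, inner ℝ h.1 x ≤ h.2}

/-- `f` is an `m`-dimensional face of the convex set `A` (for `m ≥ 1`): the set of maximisers on
`A` of some linear functional, of affine dimension `m`.
The faces of a polyhedron are those with `m = 2`, the edges of a polygon those with `m = 1`. -/
def IsFaceOfDim (m : ℕ) (A f : Set E3) : Prop :=
  IsExposed ℝ A f ∧ Module.finrank ℝ (vectorSpan ℝ f) = m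

/-- The shadow of `P` in direction `d`: its orthogonal projection onto the plane `dᗮ`. -/
noncomputable def shadow (d : E3) (P : Set E3) : Set E3 :=
  (ℝ ∙ d)ᗮ.starProjection '' P

/-- `P` is a `k`-equiprojective polyhedron: a convex polyhedron whose shadow is a `k`-gon in every
direction that is not parallel to a face of `P`. -/
def IsEquiprojective (k : ℕ) (P : Set E3) : Prop :=
  IsConvexPolyhedron P ∧
    ∀ d : E3, d ≠ 0 → (∀ f : Set E3, IsFaceOfDim 2 P f → d ∉ vectorSpan ℝ f) →
      IsConvexPolygon k (shadow d P)

/-- The union of all translates of `A` by `t • u`, `0 ≤ t ≤ 1`. -/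
def sweep (A : Set E3) (u : E3) : Set E3 :=
  A + segment ℝ 0 u

/-- `P` is a (right or oblique) `k`-gonal prism and `F` is one of its lateral faces:
`P` is swept out by a convex `k`-gon `B` under a translation `u` not parallel to its plane, so that
its bases are `B` and `u + B`, and `F` is the parallelogram swept out by an edge `e` of `B`. -/
def IsPrismWithLateralFace (k : ℕ) (P F : Set E3) : Prop :=
  ∃ (B : Set E3) (u : E3), IsConvexPolygon k B ∧ u ∉ vectorSpan ℝ B ∧ P = sweep B u ∧
    ∃ e : Set E3, IsFaceOfDim 1 B e ∧ F = sweep e u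

/-- `P` is an equiprojective bi-prism: a `k₁`-gonal and a `k₂`-gonal prism meeting exactly in a
common lateral face `F`, such that their union `P` is convex and the vertices of `F` are
vertices of `P`. -/
def IsBiPrism (k₁ k₂ : ℕ) (P : Set E3) : Prop :=
  ∃ P₁ P₂ F : Set E3,
    IsPrismWithLateralFace k₁ P₁ F ∧ IsPrismWithLateralFace k₂ P₂ F ∧
      P₁ ∩ P₂ = F ∧ P = P₁ ∪ P₂ ∧ Convex ℝ P ∧
      F.extremePoints ℝ ⊆ P.extremePoints ℝ

/-! Fix a direction `d` parallel to no facet of `P` and a linear projection `p` along `d` onto a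
plane. The sets `p '' P₁` and `p '' P₂` have union `p '' P`. They meet exactly in `p '' F`: a
segment joining two points with the same image stays in `P` and so crosses `P₁ ∩ P₂`
(`image_inter_image_of_convex_union`).

Vertices of planar convex sets with convex union obey inclusion-exclusion, provided that each vertex
of the intersection lying on the boundary of the union is a vertex of the union
(`ncard_extremePoints_union_add_inter`). The assumption that the vertices of `F` are vertices of `P`
supplies this condition (`mem_extremePoints_image_of_notMem_interior`).

It remains to count the vertices of each projected prism. Facets of `Pᵢ` other than `F` lie in
facets of `P` (`toExposed_subset_toExposed_union`), so `d` is parallel to none of them, though it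
may be parallel to `F`. Hence the base projects injectively to a `kᵢ`-gon, which is swept along `p
uᵢ ≠ 0`. A sweep duplicates the vertices that are alone on their line of direction `p uᵢ`
(`ncard_extremePoints_add_segment`). If `p '' F` is a parallelogram there are two of these, giving
`kᵢ + 2` vertices; if it is a segment there is one, giving `kᵢ + 1`
(`ncard_extremePoints_image_prism`). The shape of `p '' F` is common to both prisms, so the total is
`(k₁ + 2) + (k₂ + 2) - 4` or `(k₁ + 1) + (k₂ + 1) - 2`. -/

/-! ### Extreme points of unions and intersections of planar convex sets. -/

section ExtremePoints

variable {V : Type*} [NormedAddCommGroup V] [NormedSpace ℝ V]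

/-- Being an extreme point of a convex set is a local property. -/
theorem Convex.mem_extremePoints_of_inter_nhds {A N : Set V} {x : V} (hA : Convex ℝ A)
    (hN : N ∈ nhds x) (hx : x ∈ (A ∩ N).extremePoints ℝ) : x ∈ A.extremePoints ℝ := by
  refine ⟨hx.1.1, fun y hy z hz hxyz => ?_⟩
  have hev : ∀ w : V, ∀ᶠ t : ℝ in nhdsWithin 0 (Set.Ioi 0), x + t • (w - x) ∈ N := by
    intro w
    have hc : Continuous fun t : ℝ => x + t • (w - x) := by fun_prop
    exact (hc.tendsto' 0 x (by simp)).mono_left nhdsWithin_le_nhds hN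
  have h1 : ∀ᶠ t : ℝ in nhdsWithin 0 (Set.Ioi 0), t ∈ Set.Ioo (0 : ℝ) 1 :=
    Ioo_mem_nhdsGT one_pos
  obtain ⟨t, hty, htz, ht0, ht1⟩ := ((hev y).and ((hev z).and h1)).exists
  have hxA : x ∈ A := hx.1.1
  have hyA : x + t • (y - x) ∈ A := hA.add_smul_sub_mem hxA hy ⟨ht0.le, ht1.le⟩
  have hzA : x + t • (z - x) ∈ A := hA.add_smul_sub_mem hxA hz ⟨ht0.le, ht1.le⟩
  obtain ⟨a, b, ha, hb, hab, hx'⟩ := hxyz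
  -- Contracting `y` and `z` towards `x` by the same factor keeps `x` between them in the same
  -- ratio.
  have hmem : x ∈ openSegment ℝ (x + t • (y - x)) (x + t • (z - x)) := by
    refine ⟨a, b, ha, hb, hab, ?_⟩
    have : a • (x + t • (y - x)) + b • (x + t • (z - x))
        = (1 - t) • ((a + b) • x) + t • (a • y + b • z) := by
      have e : (1 - t) • ((a + b) • x) = (a + b) • x - t • ((a + b) • x) := by module
      rw [e]; module
    rw [this, hab, hx']; module
  have := hx.2 ⟨hyA, hty⟩ ⟨hzA, htz⟩ hmem
  have h0 : t • (y - x) = 0 := by simpa using this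
  rcases smul_eq_zero.1 h0 with h | h
  · exact absurd h ht0.ne'
  · exact sub_eq_zero.1 h

theorem notMem_extremePoints_of_mem_interior [Nontrivial V] {A : Set V} {x : V}
    (hx : x ∈ interior A) : x ∉ A.extremePoints ℝ := by
  intro h
  obtain ⟨v, hv⟩ := exists_ne (0 : V)
  have hev : ∀ w : V, ∀ᶠ t : ℝ in nhdsWithin 0 (Set.Ioi 0), x + t • w ∈ A := by
    intro w
    have hc : Continuous fun t : ℝ => x + t • w := by fun_prop
    exact (hc.tendsto' 0 x (by simp)).mono_left nhdsWithin_le_nhds (mem_interior_iff_mem_nhds.1 hx)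
  obtain ⟨t, h1, h2, ht⟩ := ((hev v).and ((hev (-v)).and self_mem_nhdsWithin)).exists
  have := h.2 h1 h2 ⟨1/2, 1/2, by norm_num, by norm_num, by norm_num, by module⟩
  have h0 : t • v = 0 := by simpa using this
  rcases smul_eq_zero.1 h0 with h | h
  · exact absurd h (ne_of_gt ht)
  · exact hv h

/-- In a plane, every linear functional vanishes on some nonzero vector. -/
theorem exists_ne_zero_apply_eq_zero (hV : Module.finrank ℝ V = 2) (f : StrongDual ℝ V) :
    ∃ v : V, v ≠ 0 ∧ f v = 0 := by
  have : FiniteDimensional ℝ V := Module.finite_of_finrank_pos (by omega)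
  have h : LinearMap.ker (f : V →ₗ[ℝ] ℝ) ≠ ⊥ :=
    LinearMap.ker_ne_bot_of_finrank_lt (by simp [hV])
  obtain ⟨v, hv, hv0⟩ := Submodule.exists_mem_ne_zero_of_ne_bot h
  exact ⟨v, hv0, by simpa using hv⟩

theorem exists_apply_pos {f : StrongDual ℝ V} (hf : f ≠ 0) : ∃ v, 0 < f v := by
  by_contra! h
  apply hf
  ext v
  have h1 := h v
  have h2 := h (-v)
  simp only [map_neg] at h2
  simp only [zero_apply]
  linarith

/-- If two closed convex sets in the plane cover a neighbourhood of a point which is extreme in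
their intersection, then the point is interior to one of them. -/
theorem mem_interior_or_of_mem_interior_union (hV : Module.finrank ℝ V = 2) {K L : Set V} {x : V}
    (hK : Convex ℝ K) (hL : Convex ℝ L) (hKc : IsClosed K) (hLc : IsClosed L)
    (hKi : (interior K).Nonempty) (hLi : (interior L).Nonempty)
    (hx : x ∈ (K ∩ L).extremePoints ℝ) (hxU : x ∈ interior (K ∪ L)) :
    x ∈ interior K ∨ x ∈ interior L := by
  by_contra! hcon
  obtain ⟨f, hf0, hf⟩ := geometric_hahn_banach_of_nonempty_interior_point hK hcon.1 hKi
  obtain ⟨g, hg0, hg⟩ := geometric_hahn_banach_of_nonempty_interior_point hL hcon.2 hLi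
  have hev : ∀ v : V, ∀ᶠ t : ℝ in nhdsWithin 0 (Set.Ioi 0), x + t • v ∈ K ∪ L := by
    intro w
    have hc : Continuous fun t : ℝ => x + t • w := by fun_prop
    exact (hc.tendsto' 0 x (by simp)).mono_left nhdsWithin_le_nhds
      (mem_interior_iff_mem_nhds.1 hxU)
  -- A direction increasing both supporting functionals would leave `K` and `L` at once, although
  -- they cover a neighbourhood of `x`.
  have hfg : ∀ v, ¬ (0 < f v ∧ 0 < g v) := by
    rintro v ⟨h1, h2⟩
    obtain ⟨t, ht, ht0 : 0 < t⟩ := ((hev v).and self_mem_nhdsWithin).exists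
    rcases ht with ht | ht
    · have := hf _ ht
      simp only [map_add, map_smul, smul_eq_mul] at this
      nlinarith [mul_pos ht0 h1]
    · have := hg _ ht
      simp only [map_add, map_smul, smul_eq_mul] at this
      nlinarith [mul_pos ht0 h2]
  have perturb : ∀ {a b : StrongDual ℝ V} (v w : V), a v = 0 → 0 < b v → 0 < a w →
      ∃ z, 0 < a z ∧ 0 < b z := by
    intro a b v w hv hbv hw
    have hc : Continuous fun t : ℝ => b (v + t • w) := by fun_prop
    have : ∀ᶠ t : ℝ in nhdsWithin 0 (Set.Ioi 0), 0 < b (v + t • w) :=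
      (hc.tendsto' 0 (b v) (by simp)).mono_left nhdsWithin_le_nhds (lt_mem_nhds hbv)
    obtain ⟨t, ht, ht0 : 0 < t⟩ := (this.and self_mem_nhdsWithin).exists
    exact ⟨v + t • w, by simpa [hv] using mul_pos ht0 hw, ht⟩
  obtain ⟨v, hv0, hfv⟩ := exists_ne_zero_apply_eq_zero hV f
  obtain ⟨w, hw⟩ := exists_apply_pos hf0
  obtain ⟨w', hw'⟩ := exists_apply_pos hg0
  -- If `g v ≠ 0`, then `v` or `-v` could be perturbed into a direction where both functionals are
  -- positive; so `f` and `g` share their kernel line.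
  have hgv : g v = 0 := by
    rcases lt_trichotomy (g v) 0 with h | h | h
    · obtain ⟨z, hz⟩ := perturb (a := f) (b := g) (-v) w (by simp [hfv]) (by simpa using h) hw
      exact absurd hz (hfg z)
    · exact h
    · obtain ⟨z, hz⟩ := perturb (a := f) (b := g) v w hfv h hw
      exact absurd hz (hfg z)
  -- every small multiple of a vector of the common kernel lies in both sets
  have key : ∀ v : V, f v = 0 → g v = 0 →
      ∀ᶠ t : ℝ in nhdsWithin 0 (Set.Ioi 0), x + t • v ∈ K ∩ L := by
    intro v hfv hgv
    have hc : Continuous fun t : ℝ => x + t • v := by fun_prop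
    have h1 : ∀ᶠ t : ℝ in nhdsWithin 0 (Set.Ioi 0), x + t • v ∈ interior (K ∪ L) :=
      (hc.tendsto' 0 x (by simp)).mono_left nhdsWithin_le_nhds (isOpen_interior.mem_nhds hxU)
    filter_upwards [h1] with t ht
    have hlim : ∀ z : V, Filter.Tendsto (fun s : ℝ => x + t • v + s • z)
        (nhdsWithin 0 (Set.Ioi 0)) (nhds (x + t • v)) := fun z =>
      ((by fun_prop : Continuous fun s : ℝ => x + t • v + s • z).tendsto' 0 _
        (by simp)).mono_left nhdsWithin_le_nhds
    have hU : ∀ z : V, ∀ᶠ s : ℝ in nhdsWithin 0 (Set.Ioi 0), x + t • v + s • z ∈ K ∪ L :=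
      fun z => hlim z (mem_interior_iff_mem_nhds.1 ht)
    constructor
    -- Moving off the common line in a direction where `g` grows leaves `L`, hence stays in `K`; let
    -- the displacement tend to `0`.
    · refine hKc.mem_of_tendsto (hlim w') ?_
      filter_upwards [hU w', self_mem_nhdsWithin] with s hs (hs0 : 0 < s)
      refine hs.resolve_right fun h => ?_
      have := hg _ h
      simp only [map_add, map_smul, smul_eq_mul, hgv] at this
      nlinarith [mul_pos hs0 hw']
    · refine hLc.mem_of_tendsto (hlim w) ?_
      filter_upwards [hU w, self_mem_nhdsWithin] with s hs (hs0 : 0 < s)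
      refine hs.resolve_left fun h => ?_
      have := hf _ h
      simp only [map_add, map_smul, smul_eq_mul, hfv] at this
      nlinarith [mul_pos hs0 hw]
  obtain ⟨t, h1, h2, ht : 0 < t⟩ := ((key v hfv hgv).and ((key (-v) (by simp [hfv])
    (by simp [hgv])).and self_mem_nhdsWithin)).exists
  have := hx.2 h1 h2 ⟨1/2, 1/2, by norm_num, by norm_num, by norm_num, by module⟩
  have h0 : t • v = 0 := by simpa using this
  rcases smul_eq_zero.1 h0 with h | h
  · exact ht.ne' h
  · exact hv0 h

/-- Inclusion-exclusion for the vertices of two convex sets in the plane with convex union, when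
the boundary vertices of the intersection are vertices of the union. -/
theorem ncard_extremePoints_union_add_inter (hV : Module.finrank ℝ V = 2) {K L : Set V}
    (hK : Convex ℝ K) (hL : Convex ℝ L) (hU : Convex ℝ (K ∪ L))
    (hKc : IsClosed K) (hLc : IsClosed L)
    (hKi : (interior K).Nonempty) (hLi : (interior L).Nonempty)
    (hfin : (K.extremePoints ℝ).Finite) (hfinL : (L.extremePoints ℝ).Finite)
    (hvert : ∀ x ∈ (K ∩ L).extremePoints ℝ, x ∉ interior (K ∪ L) →
      x ∈ (K ∪ L).extremePoints ℝ) :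
    ((K ∪ L).extremePoints ℝ).ncard + ((K ∩ L).extremePoints ℝ).ncard
      = (K.extremePoints ℝ).ncard + (L.extremePoints ℝ).ncard := by
  have : Nontrivial V := Module.nontrivial_of_finrank_pos (R := ℝ) (by omega)
  have sub : ∀ {A B : Set V} {x : V}, B ⊆ A → x ∈ B → x ∈ A.extremePoints ℝ →
      x ∈ B.extremePoints ℝ := fun h hB hA =>
    inter_extremePoints_subset_extremePoints_of_subset h ⟨hB, hA⟩
  have outer : ∀ {K L : Set V} {x : V}, Convex ℝ (K ∪ L) → IsClosed L →
      x ∈ K.extremePoints ℝ → x ∉ L → x ∈ (K ∪ L).extremePoints ℝ := by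
    intro K L x hU hLc hx hxL
    refine hU.mem_extremePoints_of_inter_nhds (hLc.isOpen_compl.mem_nhds hxL) ?_
    exact sub (fun y hy => hy.1.resolve_right hy.2) ⟨Or.inl hx.1, hxL⟩ hx
  have inner : ∀ {K L : Set V} {x : V}, Convex ℝ L → x ∈ (K ∩ L).extremePoints ℝ →
      x ∈ interior K → x ∈ L.extremePoints ℝ := by
    intro K L x hL hx hxK
    refine hL.mem_extremePoints_of_inter_nhds (mem_interior_iff_mem_nhds.1 hxK) ?_
    rwa [Set.inter_comm]
  -- The count follows from two set identities: the vertex sets of `K ∪ L` and `K ∩ L` have the same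
  -- union and the same intersection as those of `K` and `L`.
  have hunion : (K ∪ L).extremePoints ℝ ∪ (K ∩ L).extremePoints ℝ
      = K.extremePoints ℝ ∪ L.extremePoints ℝ := by
    ext x
    constructor
    · rintro (h | h)
      · exact h.1.imp (fun hx => sub Set.subset_union_left hx h)
          (fun hx => sub Set.subset_union_right hx h)
      · by_cases hi : x ∈ interior (K ∪ L)
        · rcases mem_interior_or_of_mem_interior_union hV hK hL hKc hLc hKi hLi h hi with h' | h'
          · exact Or.inr (inner hL h h')
          · rw [Set.inter_comm] at h
            exact Or.inl (inner hK h h')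
        · exact Or.inl (sub Set.subset_union_left h.1.1 (hvert x h hi))
    · rintro (h | h)
      · by_cases hx : x ∈ L
        · exact Or.inr (sub Set.inter_subset_left ⟨h.1, hx⟩ h)
        · exact Or.inl (outer hU hLc h hx)
      · by_cases hx : x ∈ K
        · exact Or.inr (sub Set.inter_subset_right ⟨hx, h.1⟩ h)
        · rw [Set.union_comm K L] at hU ⊢
          exact Or.inl (outer hU hKc h hx)
  have hinter : (K ∪ L).extremePoints ℝ ∩ (K ∩ L).extremePoints ℝ
      = K.extremePoints ℝ ∩ L.extremePoints ℝ := by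
    ext x
    constructor
    · rintro ⟨h, h'⟩
      exact ⟨sub Set.subset_union_left h'.1.1 h, sub Set.subset_union_right h'.1.2 h⟩
    · rintro ⟨h, h'⟩
      have hx : x ∈ (K ∩ L).extremePoints ℝ := sub Set.inter_subset_left ⟨h.1, h'.1⟩ h
      refine ⟨hvert x hx fun hi => ?_, hx⟩
      rcases mem_interior_or_of_mem_interior_union hV hK hL hKc hLc hKi hLi hx hi with hi | hi
      · exact notMem_extremePoints_of_mem_interior hi h
      · exact notMem_extremePoints_of_mem_interior hi h'
  have hf : ((K ∪ L).extremePoints ℝ ∪ (K ∩ L).extremePoints ℝ).Finite :=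
    hunion ▸ hfin.union hfinL
  rw [← Set.ncard_union_add_ncard_inter _ _ (hf.subset Set.subset_union_left)
    (hf.subset Set.subset_union_right), hunion, hinter,
    Set.ncard_union_add_ncard_inter _ _ hfin hfinL]

end ExtremePoints

/-! ### Polytopes as finite intersections of half-spaces, by polarity. -/

section Polytopes

variable {V : Type*} [NormedAddCommGroup V] [InnerProductSpace ℝ V]

/-- A bounded intersection of finitely many half-spaces has finitely many vertices. -/
theorem finite_extremePoints_iInter_halfSpace {S : Set V} (hS : S.Finite) (c : V → ℝ) :
    ({y : V | ∀ s ∈ S, inner ℝ s y ≤ c s}.extremePoints ℝ).Finite := by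
  set Q := {y : V | ∀ s ∈ S, inner ℝ s y ≤ c s} with hQ
  -- A vertex is determined by its tight constraints: if `x` and `y` share them, the line through
  -- `x` and `y` stays in `Q` slightly beyond `x`, so `x` is not extreme unless `x = y`.
  have hinj : Set.InjOn (fun y => {s ∈ S | inner ℝ s y = c s}) (Q.extremePoints ℝ) := by
    intro x hx y hy hxy
    simp only at hxy
    have hev : ∀ s ∈ S, ∀ᶠ t : ℝ in nhdsWithin 0 (Set.Ioi 0),
        inner ℝ s (x + t • (x - y)) ≤ c s := by
      intro s hs
      by_cases hsx : inner ℝ s x = c s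
      · have hsy : s ∈ {s ∈ S | inner ℝ s y = c s} := hxy ▸ ⟨hs, hsx⟩
        refine Filter.Eventually.of_forall fun t => ?_
        simp [inner_add_right, inner_smul_right, inner_sub_right, hsx, hsy.2]
      · have hlt : inner ℝ s x < c s := lt_of_le_of_ne (hx.1 s hs) hsx
        have hc : Continuous fun t : ℝ => inner ℝ s (x + t • (x - y)) := by fun_prop
        have := (hc.tendsto' 0 (inner ℝ s x) (by simp)).mono_left
          (nhdsWithin_le_nhds (s := Set.Ioi 0)) (gt_mem_nhds hlt)
        filter_upwards [this] with t ht using le_of_lt ht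
    have hall : ∀ᶠ t : ℝ in nhdsWithin 0 (Set.Ioi 0), x + t • (x - y) ∈ Q :=
      (hS.eventually_all).2 hev
    obtain ⟨t, ht, ht0 : 0 < t⟩ := (hall.and self_mem_nhdsWithin).exists
    have := hx.2 hy.1 ht ⟨t / (1 + t), 1 / (1 + t), by positivity, by positivity,
      by field_simp; ring, by
        rw [show x + t • (x - y) = (1 + t) • x - t • y by module, smul_sub, smul_smul, smul_smul,
          show 1 / (1 + t) * (1 + t) = 1 by field_simp,
          show 1 / (1 + t) * t = t / (1 + t) by ring]
        module⟩
    exact this.symm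
  refine Set.Finite.of_finite_image ?_ hinj
  exact hS.finite_subsets.subset (by rintro _ ⟨y, -, rfl⟩; exact fun s hs => hs.1)

/-- **Weyl's theorem** for full-dimensional polytopes: the convex hull of a finite set with
non-empty interior is an intersection of finitely many closed half-spaces. -/
theorem exists_finite_halfSpaces_of_convexHull [FiniteDimensional ℝ V] {S : Set V} (hS : S.Finite)
    (hint : (interior (convexHull ℝ S)).Nonempty) :
    ∃ H : Set (V × ℝ), H.Finite ∧ (∀ h ∈ H, h.1 ≠ 0) ∧
      convexHull ℝ S = {x : V | ∀ h ∈ H, inner ℝ h.1 x ≤ h.2} := by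
  obtain ⟨o, ho⟩ := hint
  set P := convexHull ℝ S with hP
  -- This is the polar of `P` about the interior point `o`; its vertices will be the normals of the
  -- half-spaces.
  set Q := {y : V | ∀ s ∈ S, inner ℝ s y ≤ 1 + inner ℝ o y} with hQ
  have hQ' : Q = {y : V | ∀ s ∈ (fun s => s - o) '' S, inner ℝ s y ≤ 1} := by
    ext y
    simp [hQ, inner_sub_left, add_comm]
  have hPQ : ∀ y ∈ Q, ∀ x ∈ P, inner ℝ x y ≤ 1 + inner ℝ o y := by
    intro y hy x hx
    have hconv : Convex ℝ {x : V | inner ℝ x y ≤ 1 + inner ℝ o y} := by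
      have := convex_halfSpace_le (𝕜 := ℝ) (f := fun x : V => inner ℝ x y)
        ⟨fun a b => inner_add_left a b y, fun r a => by simp [inner_smul_left]⟩ (1 + inner ℝ o y)
      exact this
    exact convexHull_min hy hconv hx
  have hQconv : Convex ℝ Q := by
    rw [hQ']
    intro a ha b hb r s hr hs hrs z hz
    rw [inner_add_right, inner_smul_right, inner_smul_right]
    nlinarith [ha z hz, hb z hz]
  have hQclosed : IsClosed Q := by
    rw [hQ, show {y : V | ∀ s ∈ S, inner ℝ s y ≤ 1 + inner ℝ o y}
      = ⋂ s ∈ S, {y : V | inner ℝ s y ≤ 1 + inner ℝ o y} by ext; simp]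
    exact isClosed_biInter fun s _ => isClosed_le (by fun_prop) (by fun_prop)
  have hQbdd : Bornology.IsBounded Q := by
    obtain ⟨r, hr, hball⟩ := Metric.mem_nhds_iff.1 (mem_interior_iff_mem_nhds.1 ho)
    refine (Metric.isBounded_closedBall (x := (0 : V)) (r := 2 / r)).subset fun y hy => ?_
    rw [mem_closedBall_zero_iff]
    by_cases hy0 : y = 0
    · simp only [hy0, norm_zero]; positivity
    have hn : 0 < ‖y‖ := norm_pos_iff.2 hy0
    -- Testing `y` against the point of `P` at distance `r / 2` from `o` in the direction of `y`
    -- gives `‖y‖ ≤ 2 / r`.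
    have hmem : o + (r / 2 / ‖y‖) • y ∈ P := by
      refine hball ?_
      rw [Metric.mem_ball, dist_eq_norm, add_sub_cancel_left, norm_smul, Real.norm_eq_abs,
        abs_of_pos (by positivity), div_mul_cancel₀ _ hn.ne']
      linarith
    have := hPQ y hy _ hmem
    rw [inner_add_left, inner_smul_left, real_inner_self_eq_norm_sq] at this
    simp only [conj_trivial] at this
    have h2 : r / 2 / ‖y‖ * ‖y‖ ^ 2 = r / 2 * ‖y‖ := by field_simp
    rw [h2] at this
    rw [le_div_iff₀ hr]
    linarith
  have hQcomp : IsCompact Q := Metric.isCompact_of_isClosed_isBounded hQclosed hQbdd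
  have hEfin : (Q.extremePoints ℝ).Finite := by
    rw [hQ']; exact finite_extremePoints_iInter_halfSpace (hS.image _) fun _ => 1
  have hKM : convexHull ℝ (Q.extremePoints ℝ) = Q := by
    rw [← (hEfin.isClosed_convexHull ℝ).closure_eq]
    exact closure_convexHull_extremePoints hQcomp hQconv
  -- The point `0` is removed to keep the normals nonzero; its constraint is the trivial `0 ≤ 1`.
  refine ⟨(fun y => (y, 1 + inner ℝ o y)) '' (Q.extremePoints ℝ \ {0}),
    (hEfin.subset Set.sdiff_subset).image _, ?_, ?_⟩
  · rintro _ ⟨y, hy, rfl⟩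
    exact hy.2
  · apply Set.Subset.antisymm
    · rintro x hx _ ⟨y, hy, rfl⟩
      simp only
      rw [real_inner_comm]
      exact hPQ y hy.1.1 x hx
    · intro x hx
      by_contra hxP
      obtain ⟨f, b, hfb, hbx⟩ := geometric_hahn_banach_closed_point (convex_convexHull ℝ S)
        (hS.isClosed_convexHull ℝ) hxP
      set z := (InnerProductSpace.toDual ℝ V).symm f with hz
      have hfz : ∀ w, f w = inner ℝ z w := fun w => by simp [hz]
      have hob : 0 < b - f o := by linarith [hfb o (interior_subset ho)]
      -- A functional separating `x` from `P`, normalised at `o`, is a point of the polar at which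
      -- `x - o` takes a value above `1`.
      have hyQ : (b - f o)⁻¹ • z ∈ Q := by
        intro s hs
        have := hfb s (subset_convexHull ℝ S hs)
        rw [inner_smul_right, inner_smul_right, real_inner_comm, real_inner_comm _ o, ← hfz, ← hfz,
          ← sub_le_iff_le_add, ← mul_sub, inv_mul_le_iff₀ hob]
        linarith
      have hle : ∀ y ∈ Q, inner ℝ (x - o) y ≤ 1 := by
        have hconv : Convex ℝ {y : V | inner ℝ (x - o) y ≤ 1} :=
          convex_halfSpace_le (𝕜 := ℝ) (f := fun y : V => inner ℝ (x - o) y)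
            ⟨fun a b => inner_add_right _ a b, fun r a => by simp [inner_smul_right]⟩ 1
        rw [← hKM]
        refine convexHull_min (fun y hy => ?_) hconv
        by_cases hy0 : y = 0
        · change inner ℝ (x - o) y ≤ 1
          simp [hy0]
        · have := hx _ ⟨y, ⟨hy, hy0⟩, rfl⟩
          simp only at this
          change inner ℝ (x - o) y ≤ 1
          rw [inner_sub_left]
          linarith [real_inner_comm x y]
      have := hle _ hyQ
      rw [inner_smul_right, real_inner_comm, ← hfz, map_sub, inv_mul_le_iff₀ hob] at this
      linarith

end Polytopes

/-! ### Vertices of a convex set swept along a segment. -/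

section SegmentSums

variable {V : Type*} [AddCommGroup V] [Module ℝ V]

theorem mem_add_segment_zero_iff {Q : Set V} {u x : V} :
    x ∈ Q + segment ℝ 0 u ↔ ∃ q ∈ Q, ∃ t ∈ Set.Icc (0 : ℝ) 1, q + t • u = x := by
  simp [Set.mem_add, segment_eq_image]

/-- A point of `Q` behind `q` puts `q` strictly between that point and `q + u`. Conversely, writing
`q` as a mixture of `a + s • u` and `b + r • u` puts `q - (α * s + β * r) • u` in `Q`, which forces
`s = r = 0`. -/
theorem mem_extremePoints_add_segment_iff {Q : Set V} (hQ : Convex ℝ Q) {u q : V} (hu : u ≠ 0)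
    (hq : q ∈ Q.extremePoints ℝ) :
    q ∈ (Q + segment ℝ 0 u).extremePoints ℝ ↔ ∀ t : ℝ, 0 < t → q - t • u ∉ Q := by
  constructor
  · intro h t ht hmem
    have h1 : q - t • u ∈ Q + segment ℝ 0 u :=
      mem_add_segment_zero_iff.2 ⟨_, hmem, 0, by simp, by simp⟩
    have h2 : q + u ∈ Q + segment ℝ 0 u :=
      mem_add_segment_zero_iff.2 ⟨q, hq.1, 1, by simp, by simp⟩
    have h3 : q - t • u = q := by
      refine h.2 h1 h2 ⟨1 / (1 + t), t / (1 + t), by positivity, by positivity, by field_simp, ?_⟩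
      rw [show t / (1 + t) = 1 / (1 + t) * t by ring, mul_smul, ← smul_add,
        show q - t • u + t • (q + u) = (1 + t) • q by module, smul_smul,
        show 1 / (1 + t) * (1 + t) = 1 by field_simp, one_smul]
    have h4 : t • u = 0 := by simpa using h3
    rcases smul_eq_zero.1 h4 with h | h
    · exact ht.ne' h
    · exact hu h
  · intro h
    refine ⟨mem_add_segment_zero_iff.2 ⟨q, hq.1, 0, by simp, by simp⟩, ?_⟩
    rintro x hx y hy ⟨α, β, hα, hβ, hαβ, hxy⟩
    obtain ⟨a, ha, s, hs, rfl⟩ := mem_add_segment_zero_iff.1 hx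
    obtain ⟨b, hb, r, hr, rfl⟩ := mem_add_segment_zero_iff.1 hy
    have hmem : q - (α * s + β * r) • u ∈ Q := by
      rw [← hxy, show α • (a + s • u) + β • (b + r • u) - (α * s + β * r) • u = α • a + β • b by
        module]
      exact hQ ha hb hα.le hβ.le hαβ
    have hle : α * s + β * r ≤ 0 := by
      by_contra! hlt
      exact h _ hlt hmem
    have hs0 : s = 0 := by
      nlinarith [mul_nonneg hα.le hs.1, mul_nonneg hβ.le hr.1, hs.1]
    have hr0 : r = 0 := by
      nlinarith [mul_nonneg hα.le hs.1, mul_nonneg hβ.le hr.1, hr.1]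
    subst hs0 hr0
    simp only [zero_smul, add_zero] at hxy ⊢
    exact hq.2 ha hb ⟨α, β, hα, hβ, hαβ, hxy⟩

/-- Mirror image of the previous criterion, at the far end of the sweep. -/
theorem add_mem_extremePoints_add_segment_iff {Q : Set V} (hQ : Convex ℝ Q) {u q : V} (hu : u ≠ 0)
    (hq : q ∈ Q.extremePoints ℝ) :
    q + u ∈ (Q + segment ℝ 0 u).extremePoints ℝ ↔ ∀ t : ℝ, 0 < t → q + t • u ∉ Q := by
  constructor
  · intro h t ht hmem
    have h1 : q + t • u + u ∈ Q + segment ℝ 0 u :=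
      mem_add_segment_zero_iff.2 ⟨_, hmem, 1, by simp, by simp⟩
    have h2 : q ∈ Q + segment ℝ 0 u :=
      mem_add_segment_zero_iff.2 ⟨q, hq.1, 0, by simp, by simp⟩
    have h3 : q + t • u + u = q + u := by
      refine h.2 h1 h2 ⟨1 / (1 + t), t / (1 + t), by positivity, by positivity, by field_simp, ?_⟩
      rw [show t / (1 + t) = 1 / (1 + t) * t by ring, mul_smul, ← smul_add,
        show q + t • u + u + t • q = (1 + t) • (q + u) by module, smul_smul,
        show 1 / (1 + t) * (1 + t) = 1 by field_simp, one_smul]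
    have h4 : t • u = 0 := by simpa using h3
    rcases smul_eq_zero.1 h4 with h | h
    · exact ht.ne' h
    · exact hu h
  · intro h
    refine ⟨mem_add_segment_zero_iff.2 ⟨q, hq.1, 1, by simp, by simp⟩, ?_⟩
    rintro x hx y hy ⟨α, β, hα, hβ, hαβ, hxy⟩
    obtain ⟨a, ha, s, hs, rfl⟩ := mem_add_segment_zero_iff.1 hx
    obtain ⟨b, hb, r, hr, rfl⟩ := mem_add_segment_zero_iff.1 hy
    have hmem : q + (1 - (α * s + β * r)) • u ∈ Q := by
      rw [show q + (1 - (α * s + β * r)) • u = (q + u) - (α * s + β * r) • u by module, ← hxy,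
        show α • (a + s • u) + β • (b + r • u) - (α * s + β * r) • u = α • a + β • b by module]
      exact hQ ha hb hα.le hβ.le hαβ
    have hle : 1 ≤ α * s + β * r := by
      by_contra! hlt
      exact h _ (by linarith) hmem
    have hs0 : s = 1 := by
      nlinarith [mul_nonneg hα.le (sub_nonneg.2 hs.2), mul_nonneg hβ.le (sub_nonneg.2 hr.2), hs.2]
    have hr0 : r = 1 := by
      nlinarith [mul_nonneg hα.le (sub_nonneg.2 hs.2), mul_nonneg hβ.le (sub_nonneg.2 hr.2), hr.2]
    subst hs0 hr0
    simp only [one_smul] at hxy ⊢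
    rw [hq.2 ha hb ⟨α, β, hα, hβ, hαβ, ?_⟩]
    have h5 : α • (a + u) + β • (b + u) = α • a + β • b + (α + β) • u := by module
    rw [h5, hαβ, one_smul] at hxy
    exact add_right_cancel hxy

theorem extremePoints_add_segment_subset {Q : Set V} {u x : V} (hu : u ≠ 0)
    (hx : x ∈ (Q + segment ℝ 0 u).extremePoints ℝ) :
    x ∈ Q.extremePoints ℝ ∨ ∃ q ∈ Q.extremePoints ℝ, q + u = x := by
  obtain ⟨q, hq, t, ht, rfl⟩ := mem_add_segment_zero_iff.1 hx.1
  have hqe : q ∈ Q.extremePoints ℝ := by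
    refine ⟨hq, ?_⟩
    rintro a ha b hb ⟨α, β, hα, hβ, hαβ, hab⟩
    have := hx.2 (mem_add_segment_zero_iff.2 ⟨a, ha, t, ht, rfl⟩)
      (mem_add_segment_zero_iff.2 ⟨b, hb, t, ht, rfl⟩) ⟨α, β, hα, hβ, hαβ, by
        rw [← hab, show α • (a + t • u) + β • (b + t • u) = α • a + β • b + (α + β) • t • u by
          module, hαβ, one_smul]⟩
    exact add_right_cancel this
  rcases ht.1.eq_or_lt with h0 | h0
  · left; simpa [← h0] using hqe
  rcases ht.2.eq_or_lt with h1 | h1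
  · right; exact ⟨q, hqe, by simp [h1]⟩
  exfalso
  have := hx.2 (mem_add_segment_zero_iff.2 ⟨q, hq, 0, by simp, by rw [zero_smul, add_zero]⟩)
    (mem_add_segment_zero_iff.2 ⟨q, hq, 1, by simp, rfl⟩)
    ⟨1 - t, t, by linarith, h0, by ring, by module⟩
  have h4 : t • u = 0 := by simpa using this
  rcases smul_eq_zero.1 h4 with h | h
  · exact h0.ne' h
  · exact hu h

/-- The points of `Q` that are extreme and alone on their line of direction `u`. -/
def lateralPoints (Q : Set V) (u : V) : Set V :=
  {q ∈ Q.extremePoints ℝ | ∀ t : ℝ, t ≠ 0 → q + t • u ∉ Q}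

/-- Sweeping a convex set along `u` duplicates exactly the extreme points that are alone on their
line of direction `u`. -/
theorem ncard_extremePoints_add_segment {Q : Set V} (hQ : Convex ℝ Q) {u : V} (hu : u ≠ 0)
    (hfin : (Q.extremePoints ℝ).Finite) :
    ((Q + segment ℝ 0 u).extremePoints ℝ).ncard
      = (Q.extremePoints ℝ).ncard + (lateralPoints Q u).ncard := by
  -- `A` collects the vertices that survive at the start of the sweep, `B` those that survive at its
  -- end. No vertex fails both tests, since it would lie between two points of `Q`; those passing
  -- both are the lateral points.
  set A := {q ∈ Q.extremePoints ℝ | ∀ t : ℝ, 0 < t → q - t • u ∉ Q} with hA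
  set B := {q ∈ Q.extremePoints ℝ | ∀ t : ℝ, 0 < t → q + t • u ∉ Q} with hB
  have hAf : A.Finite := hfin.subset fun q hq => hq.1
  have hBf : B.Finite := hfin.subset fun q hq => hq.1
  have h1 : (Q + segment ℝ 0 u).extremePoints ℝ = A ∪ (fun q => q + u) '' B := by
    ext x
    constructor
    · intro hx
      rcases extremePoints_add_segment_subset hu hx with h | ⟨q, hq, rfl⟩
      · exact Or.inl ⟨h, (mem_extremePoints_add_segment_iff hQ hu h).1 hx⟩
      · exact Or.inr ⟨q, ⟨hq, (add_mem_extremePoints_add_segment_iff hQ hu hq).1 hx⟩, rfl⟩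
    · rintro (h | ⟨q, hq, rfl⟩)
      · exact (mem_extremePoints_add_segment_iff hQ hu h.1).2 h.2
      · exact (add_mem_extremePoints_add_segment_iff hQ hu hq.1).2 hq.2
  have h2 : Disjoint A ((fun q => q + u) '' B) := by
    rw [Set.disjoint_left]
    rintro _ h ⟨q, hq, rfl⟩
    refine h.2 1 one_pos ?_
    simpa using hq.1.1
  have h3 : A ∪ B = Q.extremePoints ℝ := by
    ext q
    constructor
    · rintro (h | h) <;> exact h.1
    · intro hq
      by_contra hcon
      have hcA : q ∉ A := fun h => hcon (Or.inl h)
      have hcB : q ∉ B := fun h => hcon (Or.inr h)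
      simp only [hA, hB, Set.mem_ofPred_eq, not_and, not_forall, not_not] at hcA hcB
      obtain ⟨t, ht, htq⟩ := hcA hq
      obtain ⟨s, hs, hsq⟩ := hcB hq
      have h3 : q - t • u = q := by
        refine hq.2 htq hsq ⟨s / (s + t), t / (s + t), by positivity, by positivity,
          by field_simp, ?_⟩
        rw [div_eq_inv_mul, div_eq_inv_mul, mul_smul, mul_smul, ← smul_add,
          show s • (q - t • u) + t • (q + s • u) = (s + t) • q by module, smul_smul,
          inv_mul_cancel₀ (by positivity), one_smul]
      have h4 : t • u = 0 := by simpa using h3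
      rcases smul_eq_zero.1 h4 with h | h
      · exact ht.ne' h
      · exact hu h
  have h4 : A ∩ B = lateralPoints Q u := by
    ext q
    constructor
    · rintro ⟨h, h'⟩
      refine ⟨h.1, fun t ht => ?_⟩
      rcases ht.lt_or_gt with h0 | h0
      · have := h.2 (-t) (by linarith)
        rwa [neg_smul, sub_neg_eq_add] at this
      · exact h'.2 t h0
    · intro h
      refine ⟨⟨h.1, fun t ht => ?_⟩, ⟨h.1, fun t ht => h.2 t ht.ne'⟩⟩
      have := h.2 (-t) (by linarith)
      rwa [neg_smul, ← sub_eq_add_neg] at this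
  rw [h1, Set.ncard_union_eq h2 hAf (hBf.image _),
    Set.ncard_image_of_injective _ (add_left_injective u), ← h3, ← h4,
    Set.ncard_union_add_ncard_inter _ _ hAf hBf]

end SegmentSums

/-! ### Sweeping a planar polygon that has a distinguished edge. -/

section Planar

variable {V : Type*} [NormedAddCommGroup V] [NormedSpace ℝ V]

theorem left_mem_extremePoints_segment (a b : V) : a ∈ (segment ℝ a b).extremePoints ℝ := by
  rcases eq_or_ne a b with rfl | hab
  · simp
  refine ⟨left_mem_segment ℝ a b, ?_⟩
  rintro x hx y hy ⟨α, β, hα, hβ, hαβ, hxy⟩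
  rw [segment_eq_image'] at hx hy
  obtain ⟨s, hs, rfl⟩ := hx
  obtain ⟨r, hr, rfl⟩ := hy
  simp only at hxy ⊢
  have h1 : (α * s + β * r) • (b - a) = 0 := by
    have h2 : α • (a + s • (b - a)) + β • (a + r • (b - a))
        = (α + β) • a + (α * s + β * r) • (b - a) := by module
    rw [h2, hαβ, one_smul] at hxy
    simpa using hxy
  have h3 : α * s + β * r = 0 := (smul_eq_zero.1 h1).resolve_right (sub_ne_zero.2 hab.symm)
  have hs0 : s = 0 := by nlinarith [mul_nonneg hα.le hs.1, mul_nonneg hβ.le hr.1, hs.1]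
  simp [hs0]

theorem extremePoints_segment (a b : V) : (segment ℝ a b).extremePoints ℝ = {a, b} := by
  apply Set.Subset.antisymm
  · rw [← convexHull_pair]
    exact extremePoints_convexHull_subset
  · rintro x (rfl | rfl)
    · exact left_mem_extremePoints_segment _ _
    · rw [segment_symm]
      exact left_mem_extremePoints_segment _ _

theorem exists_smul_eq_of_apply_eq_zero (hV : Module.finrank ℝ V = 2) {φ : StrongDual ℝ V}
    (hφ : φ ≠ 0) {u v : V} (hu : u ≠ 0) (hφu : φ u = 0) (hφv : φ v = 0) : ∃ c : ℝ, c • u = v := by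
  have : FiniteDimensional ℝ V := Module.finite_of_finrank_pos (by omega)
  have hφ' : (φ : V →ₗ[ℝ] ℝ) ≠ 0 := fun h => hφ (by ext v; exact LinearMap.congr_fun h v)
  have h1 := Module.Dual.finrank_ker_add_one_of_ne_zero hφ'
  have h2 : Module.finrank ℝ (LinearMap.ker (φ : V →ₗ[ℝ] ℝ)) = 1 := by omega
  have hu' : (⟨u, hφu⟩ : LinearMap.ker (φ : V →ₗ[ℝ] ℝ)) ≠ 0 := by
    simpa [Subtype.ext_iff] using hu
  obtain ⟨c, hc⟩ := (finrank_eq_one_iff_of_nonzero' _ hu').1 h2 ⟨v, hφv⟩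
  exact ⟨c, by simpa [Subtype.ext_iff] using hc⟩

theorem exists_dual_ne_zero_apply_eq_zero (hV : Module.finrank ℝ V = 2) (u : V) :
    ∃ φ : StrongDual ℝ V, φ ≠ 0 ∧ φ u = 0 := by
  have : FiniteDimensional ℝ V := Module.finite_of_finrank_pos (by omega)
  have hlt : Submodule.span ℝ {u} < ⊤ := by
    rw [lt_top_iff_ne_top]
    intro h
    have h1 := finrank_span_le_card (R := ℝ) ({u} : Set V)
    rw [h, finrank_top, hV] at h1
    simp at h1
  obtain ⟨f, hf, hle⟩ := Submodule.exists_le_ker_of_lt_top _ hlt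
  refine ⟨LinearMap.toContinuousLinearMap f, by simpa using hf, ?_⟩
  simpa using hle (Submodule.mem_span_singleton_self u)

theorem IsCompact.toExposed_nonempty {Q : Set V} (hQ : IsCompact Q) (hne : Q.Nonempty)
    (φ : StrongDual ℝ V) : (φ.toExposed Q).Nonempty := by
  obtain ⟨x, hx, hmax⟩ := hQ.exists_isMaxOn hne φ.continuous.continuousOn
  exact ⟨x, hx, fun y hy => hmax hy⟩

/-- The level sets of `φ` are the lines of direction `u`, so `q` is the only point of `Q` at its
level. Were there points of `Q` strictly above and strictly below, the segment joining them would
cross this level at `q`, against extremality. -/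
theorem toExposed_eq_singleton_or_of_mem_lateralPoints (hV : Module.finrank ℝ V = 2) {Q : Set V}
    (hQ : Convex ℝ Q) {u : V} (hu : u ≠ 0) {φ : StrongDual ℝ V} (hφ : φ ≠ 0) (hφu : φ u = 0)
    {q : V} (hq : q ∈ lateralPoints Q u) :
    φ.toExposed Q = {q} ∨ (-φ).toExposed Q = {q} := by
  have huniq : ∀ x ∈ Q, φ x = φ q → x = q := by
    intro x hx hxq
    obtain ⟨c, hc⟩ := exists_smul_eq_of_apply_eq_zero hV hφ hu hφu (v := x - q) (by simp [hxq])
    by_contra hne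
    have hc0 : c ≠ 0 := by
      rintro rfl
      exact hne (sub_eq_zero.1 (by simpa using hc.symm))
    exact hq.2 c hc0 (by rw [hc]; simpa using hx)
  by_cases hmax : ∀ y ∈ Q, φ y ≤ φ q
  · left
    ext x
    simp only [Set.mem_singleton_iff]
    exact ⟨fun hx => huniq x hx.1 (le_antisymm (hmax x hx.1) (hx.2 q hq.1.1)),
      fun hx => hx ▸ ⟨hq.1.1, hmax⟩⟩
  by_cases hmin : ∀ y ∈ Q, φ q ≤ φ y
  · right
    ext x
    simp only [Set.mem_singleton_iff]
    refine ⟨fun hx => huniq x hx.1 (le_antisymm ?_ (hmin x hx.1)),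
      fun hx => hx ▸ ⟨hq.1.1, fun y hy => by simpa using hmin y hy⟩⟩
    simpa using hx.2 q hq.1.1
  exfalso
  push Not at hmax hmin
  obtain ⟨y, hy, hqy⟩ := hmax
  obtain ⟨z, hz, hzq⟩ := hmin
  have hpos : 0 < φ y - φ z := by linarith
  set α := (φ q - φ z) / (φ y - φ z) with hα
  set β := (φ y - φ q) / (φ y - φ z) with hβ
  have hα0 : 0 < α := div_pos (by linarith) hpos
  have hβ0 : 0 < β := div_pos (by linarith) hpos
  have hαβ : α + β = 1 := by rw [hα, hβ, ← add_div]; field_simp; ring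
  have hw : α • y + β • z ∈ Q := hQ hy hz hα0.le hβ0.le hαβ
  have hφw : φ (α • y + β • z) = φ q := by
    simp only [map_add, map_smul, smul_eq_mul, hα, hβ]
    field_simp
    ring
  have h1 := hq.1.2 hy hz ⟨α, β, hα0, hβ0, hαβ, huniq _ hw hφw⟩
  rw [h1] at hqy
  exact lt_irrefl _ hqy

theorem mem_lateralPoints_of_toExposed_eq_singleton {Q : Set V} {u : V} (hu : u ≠ 0)
    {φ : StrongDual ℝ V} (hφu : φ u = 0) {q : V} (hq : φ.toExposed Q = {q}) :
    q ∈ lateralPoints Q u := by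
  have hmem : q ∈ φ.toExposed Q := hq ▸ rfl
  refine ⟨?_, fun t ht htq => ?_⟩
  · refine exposedPoints_subset_extremePoints ?_
    rw [mem_exposedPoints_iff_exposed_singleton, ← hq]
    exact ContinuousLinearMap.toExposed.isExposed
  · have h1 : q + t • u ∈ φ.toExposed Q := ⟨htq, fun y hy => by simpa [hφu] using hmem.2 y hy⟩
    rw [hq, Set.mem_singleton_iff, add_eq_left, smul_eq_zero] at h1
    exact h1.elim ht hu

/-- The numbers of vertices of a planar convex set and of one of its edges after a sweep, when no
other edge is parallel to the sweep. -/
theorem ncard_extremePoints_add_segment_of_edge (hV : Module.finrank ℝ V = 2) {Q : Set V}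
    (hQ : Convex ℝ Q) (hQc : IsCompact Q) (hfin : (Q.extremePoints ℝ).Finite) {u a b : V}
    (hu : u ≠ 0) (hab : a ≠ b) {ψ : StrongDual ℝ V} (hψ : ψ.toExposed Q = segment ℝ a b)
    (hspan : ∀ φ : StrongDual ℝ V, φ ≠ 0 → ∃ x ∈ Q, ∃ y ∈ Q, φ x ≠ φ y)
    (hedge : ∀ φ : StrongDual ℝ V, φ ≠ 0 → φ u = 0 → ∀ x ∈ φ.toExposed Q, ∀ y ∈ φ.toExposed Q,
      x ≠ y → x ∈ segment ℝ a b ∧ y ∈ segment ℝ a b) :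
    (((segment ℝ a b + segment ℝ 0 u).extremePoints ℝ).ncard = 4 ∧
      ((Q + segment ℝ 0 u).extremePoints ℝ).ncard = (Q.extremePoints ℝ).ncard + 2) ∨
    (((segment ℝ a b + segment ℝ 0 u).extremePoints ℝ).ncard = 2 ∧
      ((Q + segment ℝ 0 u).extremePoints ℝ).ncard = (Q.extremePoints ℝ).ncard + 1) := by
  have hext := extremePoints_segment a b
  have hpair : ({a, b} : Set V).ncard = 2 := Set.ncard_pair hab
  have haψ : a ∈ ψ.toExposed Q := hψ ▸ left_mem_segment ℝ a b
  have hbψ : b ∈ ψ.toExposed Q := hψ ▸ right_mem_segment ℝ a b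
  rw [ncard_extremePoints_add_segment hQ hu hfin,
    ncard_extremePoints_add_segment (convex_segment a b) hu (by rw [hext]; simp), hext, hpair]
  obtain ⟨φ, hφ, hφu⟩ := exists_dual_ne_zero_apply_eq_zero hV u
  -- Equality means that the edge is parallel to `u`.
  by_cases hφab : φ a = φ b
  · right
    obtain ⟨c, hc⟩ := exists_smul_eq_of_apply_eq_zero hV hφ hu hφu (v := b - a) (by simp [hφab])
    have hc0 : c ≠ 0 := by
      rintro rfl
      exact hab (sub_eq_zero.1 (by simpa using hc.symm)).symm
    have hψab : ψ a = ψ b := le_antisymm (hbψ.2 a haψ.1) (haψ.2 b hbψ.1)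
    have hψu : ψ u = 0 := by
      have h1 : c * ψ u = 0 := by
        have := congrArg ψ hc
        simpa [hψab] using this
      exact (mul_eq_zero.1 h1).resolve_left hc0
    have hconst : ∀ x ∈ segment ℝ a b, φ x = φ a := by
      intro x hx
      rw [segment_eq_image'] at hx
      obtain ⟨s, -, rfl⟩ := hx
      simp [hφab]
    have hnsub : ¬ Q ⊆ segment ℝ a b := by
      intro h
      obtain ⟨x, hx, y, hy, hxy⟩ := hspan φ hφ
      exact hxy ((hconst x (h hx)).trans (hconst y (h hy)).symm)
    have hψ0 : ψ ≠ 0 := by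
      rintro rfl
      refine hnsub fun x hx => ?_
      rw [← hψ]
      exact ⟨hx, by simp⟩
    obtain ⟨m, hm⟩ := hQc.toExposed_nonempty ⟨a, haψ.1⟩ (-ψ)
    -- Two minimisers of `ψ` would lie on `[a, b]`, where `ψ` is maximal; then `ψ` would be constant
    -- on `Q` and `Q` would reduce to the edge.
    have hmin : (-ψ).toExposed Q = {m} := by
      ext x
      refine ⟨fun hx => ?_, fun hx => hx ▸ hm⟩
      by_contra hne
      have h1 := (hedge (-ψ) (neg_ne_zero.2 hψ0) (by simp [hψu]) x hx m hm hne).1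
      rw [← hψ] at h1
      refine hnsub fun y hy => ?_
      rw [← hψ]
      refine ⟨hy, fun z hz => (h1.2 z hz).trans ?_⟩
      simpa using hx.2 y hy
    have hT : lateralPoints Q u = {m} := by
      ext q
      constructor
      · intro hq
        rcases toExposed_eq_singleton_or_of_mem_lateralPoints hV hQ hu hψ0 hψu hq with h | h
        · rw [h] at haψ hbψ
          exact absurd (haψ.trans hbψ.symm) hab
        · exact hmin ▸ h ▸ rfl
      · rintro rfl
        exact mem_lateralPoints_of_toExposed_eq_singleton hu (by simp [hψu]) hmin
    have hTe : lateralPoints (segment ℝ a b) u = ∅ := by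
      rw [Set.eq_empty_iff_forall_notMem]
      rintro q ⟨hq, hq'⟩
      rw [hext] at hq
      rcases hq with rfl | rfl
      · exact hq' c hc0 (by rw [hc]; simpa using right_mem_segment ℝ _ _)
      · refine hq' (-c) (neg_ne_zero.2 hc0) ?_
        rw [neg_smul, hc]
        simpa using left_mem_segment ℝ _ _
    simp [hT, hTe]
  · left
    -- By `hedge`, two maximisers would both lie on `[a, b]`, but `φ` is injective there.
    have hsingle : ∀ φ : StrongDual ℝ V, φ ≠ 0 → φ u = 0 → φ a ≠ φ b →
        ∃ m, φ.toExposed Q = {m} := by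
      intro φ hφ hφu hφab
      obtain ⟨m, hm⟩ := hQc.toExposed_nonempty ⟨a, haψ.1⟩ φ
      refine ⟨m, ?_⟩
      ext x
      refine ⟨fun hx => ?_, fun hx => hx ▸ hm⟩
      by_contra hne
      obtain ⟨hx', hm'⟩ := hedge φ hφ hφu x hx m hm hne
      rw [segment_eq_image'] at hx' hm'
      obtain ⟨s, -, rfl⟩ := hx'
      obtain ⟨r, -, rfl⟩ := hm'
      have heq : φ (a + s • (b - a)) = φ (a + r • (b - a)) :=
        le_antisymm (hm.2 _ hx.1) (hx.2 _ hm.1)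
      simp only [map_add, map_smul, map_sub, smul_eq_mul, add_right_inj] at heq
      have hsr : s = r := mul_right_cancel₀ (sub_ne_zero.2 (Ne.symm hφab)) heq
      exact hne (by simp [hsr])
    obtain ⟨M, hM⟩ := hsingle φ hφ hφu hφab
    obtain ⟨m, hm⟩ := hsingle (-φ) (neg_ne_zero.2 hφ) (by simp [hφu]) (by simpa using hφab)
    have hMm : M ≠ m := by
      rintro rfl
      have h1 : M ∈ φ.toExposed Q := hM ▸ rfl
      have h2 : M ∈ (-φ).toExposed Q := hm ▸ rfl
      have h3 : ∀ x ∈ Q, φ x = φ M := fun x hx =>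
        le_antisymm (h1.2 x hx) (by simpa using h2.2 x hx)
      exact hφab ((h3 a haψ.1).trans (h3 b hbψ.1).symm)
    have hT : lateralPoints Q u = {M, m} := by
      ext q
      constructor
      · intro hq
        rcases toExposed_eq_singleton_or_of_mem_lateralPoints hV hQ hu hφ hφu hq with h | h
        · exact Or.inl (Set.singleton_eq_singleton_iff.1 (h.symm.trans hM))
        · exact Or.inr (Set.singleton_eq_singleton_iff.1 (h.symm.trans hm))
      · rintro (rfl | rfl)
        · exact mem_lateralPoints_of_toExposed_eq_singleton hu hφu hM
        · exact mem_lateralPoints_of_toExposed_eq_singleton hu (by simp [hφu]) hm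
    have hout : ∀ x ∈ segment ℝ a b, ∀ t : ℝ, t ≠ 0 → x + t • u ∈ segment ℝ a b → False := by
      intro x hx t ht hxt
      rw [segment_eq_image'] at hx hxt
      obtain ⟨s, -, rfl⟩ := hx
      obtain ⟨r, -, hr⟩ := hxt
      have h1 := congrArg φ hr
      simp only [map_add, map_smul, map_sub, smul_eq_mul, hφu, mul_zero, add_zero,
        add_right_inj] at h1
      have hsr : r = s := mul_right_cancel₀ (sub_ne_zero.2 (Ne.symm hφab)) h1
      subst hsr
      have h2 : t • u = 0 := by simpa using hr.symm
      exact (smul_eq_zero.1 h2).elim ht hu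
    have hTe : lateralPoints (segment ℝ a b) u = {a, b} := by
      ext q
      refine ⟨fun hq => hext ▸ hq.1, fun hq => ⟨by rw [hext]; exact hq, ?_⟩⟩
      have hq' : q ∈ segment ℝ a b := by
        rcases hq with rfl | rfl
        · exact left_mem_segment ℝ _ _
        · exact right_mem_segment ℝ _ _
      exact fun t ht h => hout q hq' t ht h
    rw [hT, hTe, hpair, Set.ncard_pair hMm]
    exact ⟨rfl, rfl⟩

end Planar

/-! ### Edges of polygons and faces of convex unions. -/

section Faces

variable {E : Type*} [NormedAddCommGroup E] [NormedSpace ℝ E]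

theorem Submodule.exists_smul_eq_of_finrank_le_one [FiniteDimensional ℝ E] {W : Submodule ℝ E}
    (hW : Module.finrank ℝ W ≤ 1) {v w : E} (hv : v ∈ W) (hw : w ∈ W) (hv0 : v ≠ 0) :
    ∃ c : ℝ, c • v = w := by
  have hv' : (⟨v, hv⟩ : W) ≠ 0 := by simpa [Subtype.ext_iff] using hv0
  have : Nontrivial W := ⟨⟨_, _, hv'⟩⟩
  have h1 : Module.finrank ℝ W = 1 := le_antisymm hW Module.finrank_pos
  obtain ⟨c, hc⟩ := (finrank_eq_one_iff_of_nonzero' _ hv').1 h1 ⟨w, hw⟩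
  exact ⟨c, by simpa [Subtype.ext_iff] using hc⟩

/-- A one-dimensional compact convex set is a segment. -/
theorem Convex.exists_eq_segment [FiniteDimensional ℝ E] {e : Set E} (he : Convex ℝ e)
    (hc : IsCompact e) (h1 : Module.finrank ℝ (vectorSpan ℝ e) = 1) :
    ∃ a b : E, a ≠ b ∧ e = segment ℝ a b := by
  have hne : e.Nonempty := by
    by_contra h
    rw [Set.not_nonempty_iff_eq_empty.1 h, vectorSpan_empty, finrank_bot] at h1
    exact zero_ne_one h1
  have hsub : ¬ e.Subsingleton := by
    intro h
    obtain ⟨x, hx⟩ := hne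
    rw [h.eq_singleton_of_mem hx, vectorSpan_singleton, finrank_bot] at h1
    exact zero_ne_one h1
  obtain ⟨x, hx, y, hy, hxy⟩ := Set.not_subsingleton_iff.1 hsub
  obtain ⟨lam, hlam⟩ := SeparatingDual.exists_eq_one (R := ℝ) (sub_ne_zero.2 hxy)
  obtain ⟨b, hb, hmax⟩ := hc.exists_isMaxOn hne lam.continuous.continuousOn
  obtain ⟨a, ha, hmin⟩ := hc.exists_isMinOn hne lam.continuous.continuousOn
  have hlt : lam a < lam b := by
    have h2 : lam x ≤ lam b := hmax hx
    have h3 : lam a ≤ lam y := hmin hy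
    rw [map_sub] at hlam
    linarith
  refine ⟨a, b, fun h => by simp [h] at hlt, Set.Subset.antisymm (fun z hz => ?_)
    (he.segment_subset ha hb)⟩
  obtain ⟨c, hc'⟩ := Submodule.exists_smul_eq_of_finrank_le_one h1.le
    (vsub_mem_vectorSpan ℝ hb ha) (vsub_mem_vectorSpan ℝ hz ha)
    (by rw [vsub_eq_sub]; exact sub_ne_zero.2 (fun h => by simp [h] at hlt))
  simp only [vsub_eq_sub] at hc'
  have h2 : c * (lam b - lam a) = lam z - lam a := by
    have := congrArg lam hc'
    simpa using this
  have h3 : lam z ≤ lam b := hmax hz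
  have h4 : lam a ≤ lam z := hmin hz
  rw [segment_eq_image']
  refine ⟨c, ⟨?_, ?_⟩, by simp only [hc']; abel⟩
  · by_contra! h; nlinarith
  · by_contra! h; nlinarith

theorem extremePoints_image_of_injOn {F : Type*} [AddCommGroup F] [Module ℝ F] {B : Set E}
    (hB : Convex ℝ B) (p : E →ₗ[ℝ] F) (hp : Set.InjOn p B) :
    (p '' B).extremePoints ℝ = p '' B.extremePoints ℝ := by
  ext x
  constructor
  · rintro ⟨⟨b, hb, rfl⟩, h⟩
    refine ⟨b, ⟨hb, ?_⟩, rfl⟩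
    rintro y hy z hz ⟨α, β, hα, hβ, hαβ, hyz⟩
    exact hp hy hb (h ⟨y, hy, rfl⟩ ⟨z, hz, rfl⟩ ⟨α, β, hα, hβ, hαβ, by simp [← hyz]⟩)
  · rintro ⟨b, ⟨hb, h⟩, rfl⟩
    refine ⟨⟨b, hb, rfl⟩, ?_⟩
    rintro _ ⟨y, hy, rfl⟩ _ ⟨z, hz, rfl⟩ ⟨α, β, hα, hβ, hαβ, hyz⟩
    have hm : α • y + β • z = b :=
      hp (hB hy hz hα.le hβ.le hαβ) hb (by simpa using hyz)
    rw [h hy hz ⟨α, β, hα, hβ, hαβ, hm⟩]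

theorem apply_le_of_mem_convexHull {S : Set E} {m : StrongDual ℝ E} {c : ℝ}
    (h : ∀ s ∈ S, m s ≤ c) : ∀ x ∈ convexHull ℝ S, m x ≤ c :=
  fun _ hx => convexHull_min (t := {x | m x ≤ c}) h
    (convex_halfSpace_le (f := m) m.toLinearMap.isLinear c) hx

/-- Next to an edge of a polygon there is another one. -/
theorem exists_adjacent_edge {S : Set E} (hS : S.Finite) {l : StrongDual ℝ E} {a b : E}
    (hab : a ≠ b) (hl : l.toExposed (convexHull ℝ S) = segment ℝ a b)
    (hne : ¬ convexHull ℝ S ⊆ segment ℝ a b) :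
    ∃ m : StrongDual ℝ E, m a ≠ m b ∧ a ∈ m.toExposed (convexHull ℝ S) ∧
      ∃ s ∈ m.toExposed (convexHull ℝ S), s ∉ segment ℝ a b := by
  have ha : a ∈ l.toExposed (convexHull ℝ S) := hl ▸ left_mem_segment ℝ a b
  obtain ⟨lam, hlam⟩ := SeparatingDual.exists_eq_one (R := ℝ) (sub_ne_zero.2 hab.symm)
  have hle : ∀ x ∈ convexHull ℝ S, l x ≤ l a := ha.2
  have hlt : ∀ x ∈ convexHull ℝ S, x ∉ segment ℝ a b → l x < l a := by
    intro x hx hxe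
    refine lt_of_le_of_ne (hle x hx) fun h => hxe ?_
    rw [← hl]
    exact ⟨hx, fun y hy => h ▸ hle y hy⟩
  set T := {s ∈ S | s ∉ segment ℝ a b} with hT
  have hTne : T.Nonempty := by
    by_contra h
    refine hne (convexHull_min (fun s hs => ?_) (convex_segment a b))
    by_contra hse
    exact h ⟨s, hs, hse⟩
  -- Rotate the supporting line of the edge about `a` until it meets a generator off the edge: `s`
  -- minimises the slope, and `-lam - μ • l` takes equal values at `a` and `s`.
  obtain ⟨s, hs, hmin⟩ := Set.exists_min_image T (fun s => lam (s - a) / (l a - l s))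
    (hS.subset fun s hs => hs.1) hTne
  set μ := lam (s - a) / (l a - l s) with hμ
  have hsH : s ∈ convexHull ℝ S := subset_convexHull ℝ S hs.1
  have hsl := hlt s hsH hs.2
  have hbound : ∀ x ∈ convexHull ℝ S, (-lam - μ • l) x ≤ (-lam - μ • l) a := by
    refine apply_le_of_mem_convexHull fun t ht => ?_
    simp only [sub_apply, neg_apply,
      smul_apply, smul_eq_mul]
    by_cases hte : t ∈ segment ℝ a b
    · have h1 : l t = l a := by
        have h2 : t ∈ l.toExposed (convexHull ℝ S) := hl ▸ hte
        exact le_antisymm (ha.2 t h2.1) (h2.2 a ha.1)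
      rw [segment_eq_image'] at hte
      obtain ⟨r, hr, rfl⟩ := hte
      have h3 : lam (a + r • (b - a)) = lam a + r := by
        rw [map_add, map_smul, hlam]; simp
      rw [h1, h3]
      linarith [hr.1]
    · have h1 := hmin t ⟨ht, hte⟩
      have h2 := hlt t (subset_convexHull ℝ S ht) hte
      rw [le_div_iff₀ (by linarith), map_sub] at h1
      linarith
  have hb : b ∈ l.toExposed (convexHull ℝ S) := hl ▸ right_mem_segment ℝ a b
  have hlab : l a = l b := le_antisymm (hb.2 a ha.1) (ha.2 b hb.1)
  refine ⟨-lam - μ • l, fun h => ?_, ⟨ha.1, hbound⟩, s, ⟨hsH, fun x hx => (hbound x hx).trans ?_⟩, hs.2⟩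
  · simp only [sub_apply, neg_apply, smul_apply, smul_eq_mul, hlab] at h
    rw [map_sub] at hlam
    linarith
  have h1 : μ * (l a - l s) = lam s - lam a := by
    rw [hμ, div_mul_cancel₀ _ (by linarith), map_sub]
  simp only [sub_apply, neg_apply,
    smul_apply, smul_eq_mul]
  linarith

/-- A maximiser of a functional on one of two closed sets with convex union which is not in the
other is a maximiser on the union. -/
theorem toExposed_subset_toExposed_union {A C : Set E} (hU : Convex ℝ (A ∪ C)) (hC : IsClosed C)
    {g : StrongDual ℝ E} {x : E} (hx : x ∈ g.toExposed A) (hxC : x ∉ C) :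
    g.toExposed A ⊆ g.toExposed (A ∪ C) := by
  have hmax : ∀ y ∈ A ∪ C, g y ≤ g x := by
    intro y hy
    by_contra! hlt
    -- A short step from `x` towards a better point `y` avoids `C`, so it stays in `A` and beats the
    -- maximum there.
    have hc : Continuous fun t : ℝ => x + t • (y - x) := by fun_prop
    have h1 : ∀ᶠ t : ℝ in nhdsWithin 0 (Set.Ioi 0), x + t • (y - x) ∉ C :=
      (hc.tendsto' 0 x (by simp)).mono_left nhdsWithin_le_nhds (hC.isOpen_compl.mem_nhds hxC)
    have h2 : ∀ᶠ t : ℝ in nhdsWithin 0 (Set.Ioi 0), t ∈ Set.Ioo (0 : ℝ) 1 := Ioo_mem_nhdsGT one_pos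
    obtain ⟨t, ht, ht0, ht1⟩ := (h1.and h2).exists
    have hmem := hU.add_smul_sub_mem (Or.inl hx.1) hy ⟨ht0.le, ht1.le⟩
    have := hx.2 _ (hmem.resolve_right ht)
    simp only [map_add, map_smul, map_sub, smul_eq_mul] at this
    nlinarith
  exact fun y hy => ⟨Or.inl hy.1, fun z hz => (hmax z hz).trans (hy.2 x hx.1)⟩

theorem vectorSpan_le_ker_of_toExposed (P : Set E) (g : StrongDual ℝ E) :
    vectorSpan ℝ (g.toExposed P) ≤ LinearMap.ker (g : E →ₗ[ℝ] ℝ) := by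
  rw [vectorSpan_def, Submodule.span_le]
  rintro _ ⟨x, hx, y, hy, rfl⟩
  have h1 := hx.2 y hy.1
  have h2 := hy.2 x hx.1
  simp only [vsub_eq_sub, SetLike.mem_coe, LinearMap.mem_ker, map_sub,
    ContinuousLinearMap.coe_coe]
  linarith

end Faces

/-! ### Projection directions and the facets they avoid. -/

/-- When `d` is parallel to no facet of `P`, the functionals vanishing on `d` attain their maximum
on a vertex or an edge of `P`. -/
theorem finrank_vectorSpan_toExposed_le_one {P : Set E3} {d : E3}
    (hface : ∀ f : Set E3, IsFaceOfDim 2 P f → d ∉ vectorSpan ℝ f) {g : StrongDual ℝ E3}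
    (hg : g ≠ 0) (hgd : g d = 0) :
    Module.finrank ℝ (vectorSpan ℝ (g.toExposed P)) ≤ 1 := by
  have hg' : (g : E3 →ₗ[ℝ] ℝ) ≠ 0 := fun h => hg (by ext v; exact LinearMap.congr_fun h v)
  have hker := Module.Dual.finrank_ker_add_one_of_ne_zero hg'
  rw [finrank_euclideanSpace_fin] at hker
  have hle := vectorSpan_le_ker_of_toExposed P g
  have h2 := Submodule.finrank_mono hle
  by_contra! hlt
  have h3 : Module.finrank ℝ (vectorSpan ℝ (g.toExposed P)) = 2 := by omega
  refine hface _ ⟨ContinuousLinearMap.toExposed.isExposed, h3⟩ ?_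
  -- A face of dimension two would have the whole plane `ker g` as its direction, and this contains
  -- `d`.
  rw [Submodule.eq_of_le_of_finrank_eq hle (by omega)]
  exact hgd

/-- With `W` the direction of a base, multiples of `h` adjust the value of a functional on `u`
without changing its maximisers on the base. -/
theorem exists_dual_eq_one_of_notMem {W : Submodule ℝ E3} {u : E3} (hu : u ∉ W) :
    ∃ h : StrongDual ℝ E3, h u = 1 ∧ ∀ w ∈ W, h w = 0 := by
  obtain ⟨f, hfu, hf⟩ := Submodule.exists_le_ker_of_notMem hu
  refine ⟨(f u)⁻¹ • LinearMap.toContinuousLinearMap f, by simp [hfu], fun w hw => ?_⟩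
  have : f w = 0 := hf hw
  simp [this]

theorem sub_mem_vectorSpan {B : Set E3} {x y : E3} (hx : x ∈ B) (hy : y ∈ B) :
    x - y ∈ vectorSpan ℝ B :=
  vsub_mem_vectorSpan ℝ hx hy

/-- A point of the base of a prism which lies on the sweep of a part of the base lies in that
part. -/
theorem mem_of_mem_add_segment {B e : Set E3} {u x : E3} (he : e ⊆ B)
    (hu : u ∉ vectorSpan ℝ B) (hx : x ∈ B) (hxe : x ∈ e + segment ℝ 0 u) : x ∈ e := by
  obtain ⟨y, hy, t, -, rfl⟩ := mem_add_segment_zero_iff.1 hxe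
  have h1 := sub_mem_vectorSpan hx (he hy)
  rw [add_sub_cancel_left] at h1
  have ht : t = 0 := by
    by_contra ht
    exact hu ((Submodule.smul_mem_iff _ ht).1 h1)
  simpa [ht] using hy

theorem add_smul_mem_toExposed_add_segment {B : Set E3} {u x : E3} {g : StrongDual ℝ E3}
    (hgu : g u = 0) (hx : x ∈ g.toExposed B) {t : ℝ} (ht : t ∈ Set.Icc (0 : ℝ) 1) :
    x + t • u ∈ g.toExposed (B + segment ℝ 0 u) := by
  refine ⟨mem_add_segment_zero_iff.2 ⟨x, hx.1, t, ht, rfl⟩, fun y hy => ?_⟩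
  obtain ⟨z, hz, s, -, rfl⟩ := mem_add_segment_zero_iff.1 hy
  simpa [hgu] using hx.2 z hz

/-! ### The projection of one prism. -/

section Prism

variable {B : Set E3} {u d a b : E3}

/-- A direction which is parallel to no facet of the prism other than the lateral facet over the
edge `[a, b]` is not parallel to the base. -/
theorem notMem_vectorSpan_base (h2 : Module.finrank ℝ (vectorSpan ℝ B) = 2)
    (hu : u ∉ vectorSpan ℝ B) (he : segment ℝ a b ⊆ B) (hne : ¬ B ⊆ segment ℝ a b)
    (hI : ∀ g : StrongDual ℝ E3, g ≠ 0 → g d = 0 → ∀ x ∈ g.toExposed (B + segment ℝ 0 u),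
      x ∉ segment ℝ a b + segment ℝ 0 u →
      Module.finrank ℝ (vectorSpan ℝ (g.toExposed (B + segment ℝ 0 u))) ≤ 1) :
    d ∉ vectorSpan ℝ B := by
  intro hd
  obtain ⟨h, hu1, hW⟩ := exists_dual_eq_one_of_notMem hu
  obtain ⟨x, hx, hxe⟩ := Set.not_subset.1 hne
  have hconst : ∀ y ∈ B, h y = h x := fun y hy => by
    have := hW _ (sub_mem_vectorSpan hy hx)
    rw [map_sub] at this
    linarith
  -- The base lies in the face exposed by `-h`, and `-h` vanishes on `d` if `d` is parallel to the
  -- base.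
  have hsub : B ⊆ (-h).toExposed (B + segment ℝ 0 u) := by
    intro y hy
    refine ⟨mem_add_segment_zero_iff.2 ⟨y, hy, 0, by simp, by simp⟩, fun z hz => ?_⟩
    obtain ⟨w, hw, t, ht, rfl⟩ := mem_add_segment_zero_iff.1 hz
    simp only [neg_apply, map_add, map_smul, hu1, smul_eq_mul, hconst w hw, hconst y hy]
    linarith [ht.1]
  have h3 := hI (-h) (fun h0 => by
    have := congrArg (fun f : StrongDual ℝ E3 => f u) h0
    simp [hu1] at this) (by simp [hW d hd]) x (hsub hx)
    (fun hxF => hxe (mem_of_mem_add_segment he hu hx hxF))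
  have h4 := Submodule.finrank_mono (vectorSpan_mono ℝ hsub)
  omega

/-- Two points of the base maximising a functional that vanishes on `u` and `d` lie on the edge
`[a, b]`. -/
theorem mem_segment_of_mem_toExposed (hu : u ∉ vectorSpan ℝ B) (he : segment ℝ a b ⊆ B)
    (hI : ∀ g : StrongDual ℝ E3, g ≠ 0 → g d = 0 → ∀ x ∈ g.toExposed (B + segment ℝ 0 u),
      x ∉ segment ℝ a b + segment ℝ 0 u →
      Module.finrank ℝ (vectorSpan ℝ (g.toExposed (B + segment ℝ 0 u))) ≤ 1)
    {g : StrongDual ℝ E3} (hg : g ≠ 0) (hgu : g u = 0) (hgd : g d = 0) {x y : E3}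
    (hx : x ∈ g.toExposed B) (hy : y ∈ g.toExposed B) (hxy : x ≠ y) : x ∈ segment ℝ a b := by
  by_contra hxe
  have hx0 := add_smul_mem_toExposed_add_segment hgu hx (t := 0) (by simp)
  have hy0 := add_smul_mem_toExposed_add_segment hgu hy (t := 0) (by simp)
  have hx1 := add_smul_mem_toExposed_add_segment hgu hx (t := 1) (by simp)
  simp only [zero_smul, one_smul, add_zero] at hx0 hy0 hx1
  -- The exposed face contains `x`, `y` and `x + u`; if it were at most one-dimensional, `u` would
  -- be a multiple of `x - y`.
  have h1 := hI g hg hgd x hx0 fun hxF => hxe (mem_of_mem_add_segment he hu hx.1 hxF)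
  obtain ⟨c, hc⟩ := Submodule.exists_smul_eq_of_finrank_le_one h1 (sub_mem_vectorSpan hx0 hy0)
    (sub_mem_vectorSpan hx1 hx0) (sub_ne_zero.2 hxy)
  rw [add_sub_cancel_left] at hc
  exact hu (hc ▸ Submodule.smul_mem _ _ (sub_mem_vectorSpan hx.1 hy.1))

/-- Such a direction is not parallel to the lateral edges either. -/
theorem smul_ne_lateral_direction {S : Set E3} (hS : S.Finite) (hB : B = convexHull ℝ S)
    (hu : u ∉ vectorSpan ℝ B) (hab : a ≠ b) {l : StrongDual ℝ E3}
    (hl : l.toExposed B = segment ℝ a b) (hne : ¬ B ⊆ segment ℝ a b)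
    (hI : ∀ g : StrongDual ℝ E3, g ≠ 0 → g d = 0 → ∀ x ∈ g.toExposed (B + segment ℝ 0 u),
      x ∉ segment ℝ a b + segment ℝ 0 u →
      Module.finrank ℝ (vectorSpan ℝ (g.toExposed (B + segment ℝ 0 u))) ≤ 1)
    (c : ℝ) : c • d ≠ u := by
  rintro hcd
  have he : segment ℝ a b ⊆ B := hl ▸ fun x hx => hx.1
  obtain ⟨m, hmab, ham, s, hsm, hse⟩ := exists_adjacent_edge (l := l) hS hab (hB ▸ hl) (hB ▸ hne)
  rw [← hB] at ham hsm
  obtain ⟨h, hu1, hW⟩ := exists_dual_eq_one_of_notMem hu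
  have hc0 : c ≠ 0 := by
    rintro rfl
    rw [zero_smul] at hcd
    exact hu (hcd ▸ Submodule.zero_mem _)
  -- On `B` this differs from `m` by a constant, so it exposes the same adjacent edge; it also
  -- vanishes on `u`, hence on `d`.
  set g := m - m u • h with hg
  have hgu : g u = 0 := by simp [hg, hu1]
  have hgd : g d = 0 := by
    rw [← hcd, map_smul, smul_eq_mul] at hgu
    exact (mul_eq_zero.1 hgu).resolve_left hc0
  have htrans : ∀ x ∈ m.toExposed B, x ∈ g.toExposed B := by
    refine fun x hx => ⟨hx.1, fun y hy => ?_⟩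
    have h1 := hW _ (sub_mem_vectorSpan hy hx.1)
    rw [map_sub] at h1
    simp only [hg, sub_apply, smul_apply, smul_eq_mul]
    have h2 : h y = h x := by linarith
    rw [h2]
    linarith [hx.2 y hy]
  have hg0 : g ≠ 0 := by
    intro hg0
    have h1 := hW _ (sub_mem_vectorSpan (he (left_mem_segment ℝ a b))
      (he (right_mem_segment ℝ a b)))
    have h2 : g (a - b) = 0 := by rw [hg0, zero_apply]
    simp only [hg, sub_apply, smul_apply, smul_eq_mul, h1, mul_zero, sub_zero] at h2
    rw [map_sub] at h2
    exact hmab (sub_eq_zero.1 h2)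
  have hsa : s ≠ a := by
    rintro rfl
    exact hse (left_mem_segment ℝ _ _)
  exact hse (mem_segment_of_mem_toExposed hu he hI hg0 hgu hgd (htrans s hsm) (htrans a ham) hsa)

/-- The numbers of vertices of the projections of a prism and of one of its lateral facets, along a
direction which is parallel to no other facet. -/
theorem ncard_extremePoints_image_prism {V : Type*} [NormedAddCommGroup V] [NormedSpace ℝ V]
    (hV : Module.finrank ℝ V = 2) (p : E3 →L[ℝ] V) (hpd : ∀ x, p x = 0 → ∃ c : ℝ, c • d = x)
    (hpd0 : p d = 0) {S : Set E3} (hS : S.Finite) (hB : B = convexHull ℝ S)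
    (h2 : Module.finrank ℝ (vectorSpan ℝ B) = 2) (hu : u ∉ vectorSpan ℝ B) (hab : a ≠ b)
    {l : StrongDual ℝ E3} (hl : l.toExposed B = segment ℝ a b) (hne : ¬ B ⊆ segment ℝ a b)
    (hI : ∀ g : StrongDual ℝ E3, g ≠ 0 → g d = 0 → ∀ x ∈ g.toExposed (B + segment ℝ 0 u),
      x ∉ segment ℝ a b + segment ℝ 0 u →
      Module.finrank ℝ (vectorSpan ℝ (g.toExposed (B + segment ℝ 0 u))) ≤ 1) :
    (((p '' (segment ℝ a b + segment ℝ 0 u)).extremePoints ℝ).ncard = 4 ∧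
      ((p '' (B + segment ℝ 0 u)).extremePoints ℝ).ncard = (B.extremePoints ℝ).ncard + 2) ∨
    (((p '' (segment ℝ a b + segment ℝ 0 u)).extremePoints ℝ).ncard = 2 ∧
      ((p '' (B + segment ℝ 0 u)).extremePoints ℝ).ncard = (B.extremePoints ℝ).ncard + 1) := by
  have : FiniteDimensional ℝ V := Module.finite_of_finrank_pos (by omega)
  have he : segment ℝ a b ⊆ B := hl ▸ fun x hx => hx.1
  have hBconv : Convex ℝ B := hB ▸ convex_convexHull ℝ S
  have hdW := notMem_vectorSpan_base h2 hu he hne hI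
  have hpu : p u ≠ 0 := by
    intro h
    obtain ⟨c, hc⟩ := hpd u h
    exact smul_ne_lateral_direction hS hB hu hab hl hne hI c hc
  have hker : ∀ w ∈ vectorSpan ℝ B, p w = 0 → w = 0 := by
    intro w hw h
    obtain ⟨c, rfl⟩ := hpd w h
    by_contra h0
    have hc : c ≠ 0 := by rintro rfl; simp at h0
    exact hdW ((Submodule.smul_mem_iff _ hc).1 hw)
  have hinj : Set.InjOn p B := by
    intro x hx y hy hxy
    exact sub_eq_zero.1 (hker _ (sub_mem_vectorSpan hx hy) (by rw [map_sub, hxy, sub_self]))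
  have hinjW : Function.Injective ((p : E3 →ₗ[ℝ] V) ∘ₗ (vectorSpan ℝ B).subtype) := by
    rw [← LinearMap.ker_eq_bot, LinearMap.ker_eq_bot']
    intro w hw
    exact Subtype.ext (hker w.1 w.2 hw)
  -- Restricted to the direction plane of the base, `p` is an isomorphism onto `V`. Through it `l`
  -- becomes a functional `ψ` exposing the projected edge.
  set eq := LinearEquiv.ofInjectiveOfFinrankEq _ hinjW (h2.trans hV.symm) with heq
  have heq_apply : ∀ w, eq w = p w := fun w => rfl
  have hext : (p '' B).extremePoints ℝ = p '' B.extremePoints ℝ :=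
    extremePoints_image_of_injOn hBconv (p : E3 →ₗ[ℝ] V) hinj
  have hextB : (B.extremePoints ℝ).Finite :=
    hS.subset (by rw [hB]; exact extremePoints_convexHull_subset)
  have hncard : ((p '' B).extremePoints ℝ).ncard = (B.extremePoints ℝ).ncard := by
    rw [hext]
    exact (hinj.mono extremePoints_subset).ncard_image
  have himg : ∀ x y : E3, p '' segment ℝ x y = segment ℝ (p x) (p y) := fun x y =>
    image_segment ℝ (p : E3 →ₗ[ℝ] V).toAffineMap x y
  have hsum : ∀ A : Set E3, p '' (A + segment ℝ 0 u) = p '' A + segment ℝ 0 (p u) := by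
    intro A
    rw [Set.image_add, himg, map_zero]
  set ψ : StrongDual ℝ V := LinearMap.toContinuousLinearMap
    ((l : E3 →ₗ[ℝ] ℝ) ∘ₗ (vectorSpan ℝ B).subtype ∘ₗ eq.symm.toLinearMap) with hψ
  have hψp : ∀ w ∈ vectorSpan ℝ B, ψ (p w) = l w := by
    intro w hw
    have h1 : eq.symm (p w) = ⟨w, hw⟩ := by
      rw [LinearEquiv.symm_apply_eq, heq_apply]
    simp [hψ, h1]
  have hψdiff : ∀ x ∈ B, ∀ y ∈ B, ψ (p x) - ψ (p y) = l x - l y := by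
    intro x hx y hy
    rw [← map_sub, ← map_sub, hψp _ (sub_mem_vectorSpan hx hy), map_sub]
  have hψexp : ψ.toExposed (p '' B) = segment ℝ (p a) (p b) := by
    rw [← himg, ← hl]
    ext z
    constructor
    · rintro ⟨⟨x, hx, rfl⟩, hmax⟩
      refine ⟨x, ⟨hx, fun y hy => ?_⟩, rfl⟩
      have h1 := hmax _ ⟨y, hy, rfl⟩
      linarith [hψdiff y hy x hx]
    · rintro ⟨x, hx, rfl⟩
      refine ⟨⟨x, hx.1, rfl⟩, ?_⟩
      rintro _ ⟨y, hy, rfl⟩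
      linarith [hψdiff y hy x hx.1, hx.2 y hy]
  have hspan : ∀ φ : StrongDual ℝ V, φ ≠ 0 → ∃ x ∈ p '' B, ∃ y ∈ p '' B, φ x ≠ φ y := by
    intro φ hφ
    by_contra! hcon
    have hle : vectorSpan ℝ B ≤ LinearMap.ker ((φ : V →ₗ[ℝ] ℝ) ∘ₗ (p : E3 →ₗ[ℝ] V)) := by
      rw [vectorSpan_def, Submodule.span_le]
      rintro _ ⟨x, hx, y, hy, rfl⟩
      have h1 := hcon _ ⟨x, hx, rfl⟩ _ ⟨y, hy, rfl⟩
      simp [h1]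
    apply hφ
    ext v
    have h1 : φ (p (eq.symm v : E3)) = 0 := hle (eq.symm v).2
    rw [← heq_apply, LinearEquiv.apply_symm_apply] at h1
    simpa using h1
  have hedge : ∀ φ : StrongDual ℝ V, φ ≠ 0 → φ (p u) = 0 → ∀ x ∈ φ.toExposed (p '' B),
      ∀ y ∈ φ.toExposed (p '' B), x ≠ y →
      x ∈ segment ℝ (p a) (p b) ∧ y ∈ segment ℝ (p a) (p b) := by
    rintro φ hφ hφu x ⟨⟨x, hx, rfl⟩, hxm⟩ y ⟨⟨y, hy, rfl⟩, hym⟩ hxy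
    have hg : φ.comp p ≠ 0 := by
      intro h0
      apply hφ
      ext v
      have h1 := congrArg (fun f : StrongDual ℝ E3 => f (eq.symm v : E3)) h0
      simp only [ContinuousLinearMap.comp_apply, zero_apply] at h1
      rw [← heq_apply, LinearEquiv.apply_symm_apply] at h1
      simpa using h1
    have hx' : x ∈ (φ.comp p).toExposed B := ⟨hx, fun z hz => hxm _ ⟨z, hz, rfl⟩⟩
    have hy' : y ∈ (φ.comp p).toExposed B := ⟨hy, fun z hz => hym _ ⟨z, hz, rfl⟩⟩
    have hxy' : x ≠ y := fun h => hxy (h ▸ rfl)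
    have hgd : (φ.comp p) d = 0 := by simp [hpd0]
    rw [← himg]
    exact ⟨⟨x, mem_segment_of_mem_toExposed hu he hI hg hφu hgd hx' hy' hxy', rfl⟩,
      ⟨y, mem_segment_of_mem_toExposed hu he hI hg hφu hgd hy' hx' hxy'.symm, rfl⟩⟩
  rw [hsum, hsum, himg, ← hncard]
  have hpab : p a ≠ p b := fun h => hab (hinj (he (left_mem_segment ℝ a b))
    (he (right_mem_segment ℝ a b)) h)
  have hBc : IsCompact (p '' B) := by
    rw [hB]
    exact (hS.isCompact_convexHull ℝ).image p.continuous
  exact ncard_extremePoints_add_segment_of_edge hV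
    (hBconv.linear_image (p : E3 →ₗ[ℝ] V)) hBc (hext ▸ hextB.image _) hpu hpab hψexp
    hspan hedge

end Prism

/-! ### Gluing the two projected prisms. -/

theorem IsPrismWithLateralFace.exists_data {k : ℕ} {P F : Set E3}
    (h : IsPrismWithLateralFace k P F) :
    ∃ (S : Set E3) (u a b : E3) (l : StrongDual ℝ E3), S.Finite ∧
      Module.finrank ℝ (vectorSpan ℝ (convexHull ℝ S)) = 2 ∧
      ((convexHull ℝ S).extremePoints ℝ).ncard = k ∧ u ∉ vectorSpan ℝ (convexHull ℝ S) ∧ a ≠ b ∧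
      l.toExposed (convexHull ℝ S) = segment ℝ a b ∧ ¬ convexHull ℝ S ⊆ segment ℝ a b ∧
      P = convexHull ℝ S + segment ℝ 0 u ∧ F = segment ℝ a b + segment ℝ 0 u := by
  obtain ⟨_, u, ⟨⟨S, hS, rfl⟩, h2, hk⟩, hu, rfl, e, ⟨he, h1⟩, rfl⟩ := h
  have hne : e.Nonempty := by
    by_contra hcon
    rw [Set.not_nonempty_iff_eq_empty.1 hcon, vectorSpan_empty, finrank_bot] at h1
    exact zero_ne_one h1
  obtain ⟨a, b, hab, hseg⟩ := (he.convex (convex_convexHull ℝ S)).exists_eq_segment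
    (he.isCompact (hS.isCompact_convexHull ℝ)) h1
  obtain ⟨l, hl⟩ := he hne
  refine ⟨S, u, a, b, l, hS, h2, hk, hu, hab, hl.symm.trans hseg, fun hsub => ?_, rfl,
    by rw [hseg]; rfl⟩
  have := Submodule.finrank_mono (vectorSpan_mono ℝ hsub)
  rw [← hseg, h1, h2] at this
  omega

theorem interior_nonempty_of_vectorSpan_eq_top {V : Type*} [NormedAddCommGroup V]
    [NormedSpace ℝ V] [FiniteDimensional ℝ V] {A : Set V} (hA : Convex ℝ A) (hne : A.Nonempty)
    (h : vectorSpan ℝ A = ⊤) : (interior A).Nonempty :=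
  hA.interior_nonempty_iff_affineSpan_eq_top.2
    ((AffineSubspace.affineSpan_eq_top_iff_vectorSpan_eq_top_of_nonempty ℝ V V hne).2 h)

theorem vectorSpan_prism_eq_top {B : Set E3} {u : E3}
    (h2 : Module.finrank ℝ (vectorSpan ℝ B) = 2) (hu : u ∉ vectorSpan ℝ B) (hne : B.Nonempty) :
    vectorSpan ℝ (B + segment ℝ 0 u) = ⊤ := by
  have hsub : B ⊆ B + segment ℝ 0 u := fun x hx =>
    mem_add_segment_zero_iff.2 ⟨x, hx, 0, by simp, by simp⟩
  obtain ⟨x, hx⟩ := hne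
  have hmem : u ∈ vectorSpan ℝ (B + segment ℝ 0 u) := by
    have := sub_mem_vectorSpan (mem_add_segment_zero_iff.2 ⟨x, hx, 1, by simp, rfl⟩) (hsub hx)
    simpa using this
  have hlt : vectorSpan ℝ B < vectorSpan ℝ (B + segment ℝ 0 u) :=
    lt_of_le_of_ne (vectorSpan_mono ℝ hsub) fun h => hu (h ▸ hmem)
  have h3 := Submodule.finrank_lt_finrank_of_lt hlt
  have h4 := Submodule.finrank_le (vectorSpan ℝ (B + segment ℝ 0 u))
  refine Submodule.eq_top_of_finrank_eq ?_
  rw [finrank_euclideanSpace_fin] at h4 ⊢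
  omega

theorem convexHull_add_segment_zero (S : Set E3) (u : E3) :
    convexHull ℝ S + segment ℝ 0 u = convexHull ℝ (S + {0, u}) := by
  rw [convexHull_add, convexHull_pair]

/-- The projection of a vertex of `P` to the boundary of the projection of `P` is a vertex, when
the direction of projection is parallel to no facet. -/
theorem mem_extremePoints_image_of_notMem_interior {V : Type*} [NormedAddCommGroup V]
    [NormedSpace ℝ V] {P : Set E3} (hP : Convex ℝ P) {d : E3} {p : E3 →L[ℝ] V}
    (hp : Function.Surjective p) (hpd0 : p d = 0)
    (hface : ∀ f : Set E3, IsFaceOfDim 2 P f → d ∉ vectorSpan ℝ f) {y : E3}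
    (hy : y ∈ P.extremePoints ℝ) (hne : (interior (p '' P)).Nonempty)
    (hyi : p y ∉ interior (p '' P)) : p y ∈ (p '' P).extremePoints ℝ := by
  -- A supporting functional at `p y` pulls back to a face of `P` of dimension at most one,
  -- containing `y` and the lifts of any two points of the projection with `p y` between them.
  obtain ⟨φ, hφ, hmax⟩ := geometric_hahn_banach_of_nonempty_interior_point
    (hP.linear_image (p : E3 →ₗ[ℝ] V)) hyi hne
  have hg : φ.comp p ≠ 0 := by
    intro h0
    apply hφ
    ext v
    obtain ⟨x, rfl⟩ := hp v
    exact congrArg (fun f : StrongDual ℝ E3 => f x) h0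
  have hfin := finrank_vectorSpan_toExposed_le_one hface hg (by simp [hpd0])
  refine ⟨⟨y, hy.1, rfl⟩, ?_⟩
  rintro _ ⟨z, hz, rfl⟩ _ ⟨w, hw, rfl⟩ ⟨α, β, hα, hβ, hαβ, hzw⟩
  have hmax' : ∀ x ∈ P, φ (p x) ≤ φ (p y) := fun x hx => hmax _ ⟨x, hx, rfl⟩
  have hval : α * φ (p z) + β * φ (p w) = φ (p y) := by
    have := congrArg φ hzw
    simpa using this
  have hα' : α = 1 - β := by linarith
  have hyG : y ∈ (φ.comp p).toExposed P := ⟨hy.1, hmax'⟩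
  have hzv : φ (p z) = φ (p y) := by
    have h1 := hmax' z hz
    have h2 := hmax' w hw
    have h3 : α * (φ (p y) - φ (p z)) + β * (φ (p y) - φ (p w)) = 0 := by
      rw [← hval, hα']; ring
    nlinarith [mul_nonneg hα.le (sub_nonneg.2 h1), mul_nonneg hβ.le (sub_nonneg.2 h2)]
  have hwv : φ (p w) = φ (p y) := by
    rw [hzv] at hval
    have h3 : β * (φ (p w) - φ (p y)) = 0 := by
      rw [hα'] at hval
      linarith
    exact sub_eq_zero.1 ((mul_eq_zero.1 h3).resolve_left hβ.ne')
  have hzG : z ∈ (φ.comp p).toExposed P :=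
    ⟨hz, fun x hx => (hmax' x hx).trans hzv.ge⟩
  have hwG : w ∈ (φ.comp p).toExposed P :=
    ⟨hw, fun x hx => (hmax' x hx).trans hwv.ge⟩
  by_contra hne'
  have hpzw : p z ≠ p w := by
    intro h
    rw [← h, ← add_smul, hαβ, one_smul] at hzw
    exact hne' hzw
  have hr : α • (y - z) + β • (y - w) ∈ vectorSpan ℝ ((φ.comp p).toExposed P) :=
    Submodule.add_mem _ (Submodule.smul_mem _ _ (sub_mem_vectorSpan hyG hzG))
      (Submodule.smul_mem _ _ (sub_mem_vectorSpan hyG hwG))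
  -- The error `y - (α • z + β • w)` is a multiple of `z - w` killed by `p`, while `p (z - w) ≠ 0`.
  -- So it vanishes, contradicting the extremality of `y`.
  obtain ⟨c, hc⟩ := Submodule.exists_smul_eq_of_finrank_le_one hfin (sub_mem_vectorSpan hzG hwG) hr
    (sub_ne_zero.2 fun h => hpzw (h ▸ rfl))
  have hexp : α • (y - z) + β • (y - w) = y - (α • z + β • w) := by
    rw [hα']; module
  rw [hexp] at hc
  have hpc := congrArg p hc
  simp only [map_smul, map_sub, map_add, hzw, sub_self] at hpc
  have hc0 : c = 0 := (smul_eq_zero.1 hpc).resolve_right (sub_ne_zero.2 hpzw)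
  rw [hc0, zero_smul] at hc
  exact hne' (congrArg p (hy.2 hz hw ⟨α, β, hα, hβ, hαβ, (sub_eq_zero.1 hc.symm).symm⟩))

/-- If two closed sets have convex union, their images under a linear map meet in the image of
their intersection. -/
theorem image_inter_image_of_convex_union {V : Type*} [NormedAddCommGroup V] [NormedSpace ℝ V]
    {A C : Set E3} (hA : IsClosed A) (hC : IsClosed C) (hU : Convex ℝ (A ∪ C)) (p : E3 →L[ℝ] V) :
    p '' A ∩ p '' C = p '' (A ∩ C) := by
  apply Set.Subset.antisymm ?_ (Set.image_inter_subset _ _ _)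
  rintro _ ⟨⟨y, hy, rfl⟩, z, hz, hzy⟩
  have hsub := hU.segment_subset (Or.inl hy) (Or.inr hz)
  -- The segment from `y` to `z` is connected and covered by the closed sets `A` and `C`, so it
  -- meets `A ∩ C`; `p` is constant on it.
  obtain ⟨w, hw, hwAC⟩ := isPreconnected_closed_iff.1 (convex_segment y z).isPreconnected A C hA hC
    hsub ⟨y, left_mem_segment ℝ y z, hy⟩ ⟨z, right_mem_segment ℝ y z, hz⟩
  refine ⟨w, hwAC, ?_⟩
  rw [segment_eq_image'] at hw
  obtain ⟨t, -, rfl⟩ := hw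
  simp [hzy]

/-- A linear projection to a plane, along a direction parallel to no facet of a bi-prism, has
`k₁ + k₂` vertices. -/
theorem IsBiPrism.ncard_extremePoints_image {k₁ k₂ : ℕ} {P : Set E3} (hP : IsBiPrism k₁ k₂ P)
    {d : E3} (hface : ∀ f : Set E3, IsFaceOfDim 2 P f → d ∉ vectorSpan ℝ f)
    {V : Type*} [NormedAddCommGroup V] [NormedSpace ℝ V] (hV : Module.finrank ℝ V = 2)
    (p : E3 →L[ℝ] V) (hp : Function.Surjective p) (hpd : ∀ x, p x = 0 → ∃ c : ℝ, c • d = x)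
    (hpd0 : p d = 0) : ((p '' P).extremePoints ℝ).ncard = k₁ + k₂ := by
  have : FiniteDimensional ℝ V := Module.finite_of_finrank_pos (by omega)
  obtain ⟨P₁, P₂, F, h₁, h₂, hF, rfl, hconv, hext⟩ := hP
  obtain ⟨S₁, u₁, a₁, b₁, l₁, hS₁, hr₁, hk₁, hu₁, hab₁, hl₁, hne₁, hP₁, hF₁⟩ := h₁.exists_data
  obtain ⟨S₂, u₂, a₂, b₂, l₂, hS₂, hr₂, hk₂, hu₂, hab₂, hl₂, hne₂, hP₂, hF₂⟩ := h₂.exists_data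
  have hH₁ : P₁ = convexHull ℝ (S₁ + {0, u₁}) := hP₁.trans (convexHull_add_segment_zero _ _)
  have hH₂ : P₂ = convexHull ℝ (S₂ + {0, u₂}) := hP₂.trans (convexHull_add_segment_zero _ _)
  have hT₁ : (S₁ + {0, u₁}).Finite := hS₁.add (Set.toFinite _)
  have hT₂ : (S₂ + {0, u₂}).Finite := hS₂.add (Set.toFinite _)
  have hc₁ : IsCompact P₁ := hH₁ ▸ hT₁.isCompact_convexHull ℝ
  have hc₂ : IsCompact P₂ := hH₂ ▸ hT₂.isCompact_convexHull ℝ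
  have hv₁ : Convex ℝ P₁ := hH₁ ▸ convex_convexHull ℝ _
  have hv₂ : Convex ℝ P₂ := hH₂ ▸ convex_convexHull ℝ _
  have hFc : IsCompact F := hF ▸ hc₁.inter hc₂
  -- A face of `P₁` with a point off `F`, hence off `P₂`, lies in a face of `P` exposed by the same
  -- functional.
  have hI₁ : ∀ g : StrongDual ℝ E3, g ≠ 0 → g d = 0 → ∀ x ∈ g.toExposed P₁, x ∉ F →
      Module.finrank ℝ (vectorSpan ℝ (g.toExposed P₁)) ≤ 1 := by
    intro g hg hgd x hx hxF
    have hx₂ : x ∉ P₂ := fun h => hxF (hF ▸ ⟨hx.1, h⟩)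
    exact (Submodule.finrank_mono (vectorSpan_mono ℝ
      (toExposed_subset_toExposed_union hconv hc₂.isClosed hx hx₂))).trans
      (finrank_vectorSpan_toExposed_le_one hface hg hgd)
  have hI₂ : ∀ g : StrongDual ℝ E3, g ≠ 0 → g d = 0 → ∀ x ∈ g.toExposed P₂, x ∉ F →
      Module.finrank ℝ (vectorSpan ℝ (g.toExposed P₂)) ≤ 1 := by
    intro g hg hgd x hx hxF
    have hx₁ : x ∉ P₁ := fun h => hxF (hF ▸ ⟨h, hx.1⟩)
    rw [Set.union_comm] at hconv hface
    exact (Submodule.finrank_mono (vectorSpan_mono ℝ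
      (toExposed_subset_toExposed_union hconv hc₁.isClosed hx hx₁))).trans
      (finrank_vectorSpan_toExposed_le_one hface hg hgd)
  have hB : ∀ {S : Set E3}, Module.finrank ℝ (vectorSpan ℝ (convexHull ℝ S)) = 2 →
      (convexHull ℝ S).Nonempty := by
    intro S h
    by_contra hcon
    rw [Set.not_nonempty_iff_eq_empty.1 hcon, vectorSpan_empty, finrank_bot] at h
    omega
  have hopen : IsOpenMap p := p.isOpenMap hp
  have hint : ∀ {A : Set E3}, (interior A).Nonempty → (interior (p '' A)).Nonempty :=
    fun h => (h.image p).mono (hopen.image_interior_subset _)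
  have hi₁ : (interior P₁).Nonempty := by
    refine interior_nonempty_of_vectorSpan_eq_top hv₁ (hP₁ ▸ (hB hr₁).add ⟨0, ?_⟩)
      (hP₁ ▸ vectorSpan_prism_eq_top hr₁ hu₁ (hB hr₁))
    exact left_mem_segment ℝ _ _
  have hi₂ : (interior P₂).Nonempty := by
    refine interior_nonempty_of_vectorSpan_eq_top hv₂ (hP₂ ▸ (hB hr₂).add ⟨0, ?_⟩)
      (hP₂ ▸ vectorSpan_prism_eq_top hr₂ hu₂ (hB hr₂))
    exact left_mem_segment ℝ _ _
  have hfin : ∀ {T : Set E3}, T.Finite → ((p '' convexHull ℝ T).extremePoints ℝ).Finite := by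
    intro T hT
    have h1 : p '' convexHull ℝ T = convexHull ℝ (p '' T) :=
      (p : E3 →ₗ[ℝ] V).image_convexHull T
    rw [h1]
    exact (hT.image p).subset extremePoints_convexHull_subset
  have hinter : p '' P₁ ∩ p '' P₂ = p '' F := by
    rw [image_inter_image_of_convex_union hc₁.isClosed hc₂.isClosed hconv, hF]
  have hunion : p '' P₁ ∪ p '' P₂ = p '' (P₁ ∪ P₂) := (Set.image_union _ _ _).symm
  have hvert : ∀ x ∈ (p '' P₁ ∩ p '' P₂).extremePoints ℝ, x ∉ interior (p '' P₁ ∪ p '' P₂) →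
      x ∈ (p '' P₁ ∪ p '' P₂).extremePoints ℝ := by
    intro x hx hxi
    rw [hinter] at hx
    rw [hunion] at hxi ⊢
    obtain ⟨y, hy, rfl⟩ := surjOn_extremePoints_image p.toContinuousAffineMap hFc hx
    exact mem_extremePoints_image_of_notMem_interior hconv hp hpd0 hface (hext hy)
      (hint (hi₁.mono (interior_mono Set.subset_union_left))) hxi
  have hcount := ncard_extremePoints_union_add_inter hV
    (hv₁.linear_image (p : E3 →ₗ[ℝ] V)) (hv₂.linear_image (p : E3 →ₗ[ℝ] V))
    (hunion ▸ hconv.linear_image (p : E3 →ₗ[ℝ] V))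
    (hc₁.image p.continuous).isClosed (hc₂.image p.continuous).isClosed (hint hi₁) (hint hi₂)
    (hH₁ ▸ hfin hT₁) (hH₂ ▸ hfin hT₂) hvert
  have hn₁ := ncard_extremePoints_image_prism hV p hpd hpd0 hS₁ rfl hr₁ hu₁ hab₁ hl₁ hne₁
    (by rw [← hP₁, ← hF₁]; exact hI₁)
  have hn₂ := ncard_extremePoints_image_prism hV p hpd hpd0 hS₂ rfl hr₂ hu₂ hab₂ hl₂ hne₂
    (by rw [← hP₂, ← hF₂]; exact hI₂)
  rw [← hP₁, ← hF₁, hk₁] at hn₁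
  rw [← hP₂, ← hF₂, hk₂] at hn₂
  change ((p '' P₁ ∪ p '' P₂).extremePoints ℝ).ncard
    + ((p '' P₁ ∩ p '' P₂).extremePoints ℝ).ncard
    = ((p '' P₁).extremePoints ℝ).ncard + ((p '' P₂).extremePoints ℝ).ncard at hcount
  rw [hinter, hunion] at hcount
  -- The mixed cases are excluded because both alternatives count the vertices of the same set `p ''
  -- F`, as 4 or as 2.
  omega

/-- A convex union of two convex hulls is the hull of all the generators; one prism alone already
spans the space. -/
theorem IsBiPrism.exists_convexHull {k₁ k₂ : ℕ} {P : Set E3} (hP : IsBiPrism k₁ k₂ P) :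
    (∃ T : Set E3, T.Finite ∧ P = convexHull ℝ T) ∧ vectorSpan ℝ P = ⊤ ∧ P.Nonempty := by
  obtain ⟨P₁, P₂, F, h₁, h₂, hF, rfl, hconv, hext⟩ := hP
  obtain ⟨S₁, u₁, a₁, b₁, l₁, hS₁, hr₁, -, hu₁, -, hl₁, -, hP₁, -⟩ := h₁.exists_data
  obtain ⟨S₂, u₂, a₂, b₂, l₂, hS₂, hr₂, hk₂, hu₂, hab₂, hl₂, hne₂, hP₂, hF₂⟩ := h₂.exists_data
  have ha : a₁ ∈ convexHull ℝ S₁ := by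
    have : a₁ ∈ l₁.toExposed (convexHull ℝ S₁) := hl₁ ▸ left_mem_segment ℝ _ _
    exact this.1
  refine ⟨⟨(S₁ + {0, u₁}) ∪ (S₂ + {0, u₂}), (hS₁.add (Set.toFinite _)).union
    (hS₂.add (Set.toFinite _)), ?_⟩, ?_, ?_⟩
  · rw [hP₁, hP₂, convexHull_add_segment_zero, convexHull_add_segment_zero] at hconv ⊢
    refine Set.Subset.antisymm (Set.union_subset (convexHull_mono Set.subset_union_left)
      (convexHull_mono Set.subset_union_right)) (convexHull_min (Set.union_subset_union
        (subset_convexHull ℝ _) (subset_convexHull ℝ _)) hconv)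
  · rw [eq_top_iff, ← vectorSpan_prism_eq_top hr₁ hu₁ ⟨a₁, ha⟩, ← hP₁]
    exact vectorSpan_mono ℝ Set.subset_union_left
  · rw [hP₁]
    exact ⟨a₁, Or.inl (mem_add_segment_zero_iff.2 ⟨a₁, ha, 0, by simp, by simp⟩)⟩

/-! ### The theorem, with `p` the orthogonal projection along `d`. -/

theorem mainTheorem7 (k₁ k₂ : ℕ) (P : Set E3) (hP : IsBiPrism k₁ k₂ P) :
    IsEquiprojective (k₁ + k₂) P := by
  obtain ⟨⟨T, hT, hPT⟩, hspan, hne⟩ := hP.exists_convexHull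
  have hint : (interior P).Nonempty :=
    interior_nonempty_of_vectorSpan_eq_top (hPT ▸ convex_convexHull ℝ T) hne hspan
  refine ⟨⟨?_, hint, ?_⟩, fun d hd hface => ?_⟩
  · rw [hPT]
    exact (hT.isCompact_convexHull ℝ).isBounded
  · rw [hPT] at hint ⊢
    exact exists_finite_halfSpaces_of_convexHull hT hint
  have : Fact (Module.finrank ℝ E3 = 2 + 1) := ⟨finrank_euclideanSpace_fin⟩
  have hV : Module.finrank ℝ (ℝ ∙ d)ᗮ = 2 := Submodule.finrank_orthogonal_span_singleton hd
  have hp : Function.Surjective (ℝ ∙ d)ᗮ.orthogonalProjectionOnto := fun v => ⟨v, by simp⟩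
  have hker : ∀ x, (ℝ ∙ d)ᗮ.orthogonalProjectionOnto x = 0 ↔ ∃ c : ℝ, c • d = x := by
    intro x
    rw [← Submodule.mem_span_singleton]
    conv_rhs => rw [← (ℝ ∙ d).orthogonal_orthogonal, ← Submodule.ker_orthogonalProjectionOnto]
    rfl
  have hcount := hP.ncard_extremePoints_image hface hV _ hp (fun x => (hker x).1)
    ((hker d).2 ⟨1, one_smul _ _⟩)
  -- The shadow lies in space while the count takes place in the plane `(ℝ ∙ d)ᗮ`; the injective
  -- inclusion preserves the number of vertices.
  have hshadow : shadow d P =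
      (ℝ ∙ d)ᗮ.subtype '' ((ℝ ∙ d)ᗮ.orthogonalProjectionOnto '' P) := by
    rw [Set.image_image]; rfl
  have hconv : Convex ℝ ((ℝ ∙ d)ᗮ.orthogonalProjectionOnto '' P) := by
    rw [hPT]
    exact (convex_convexHull ℝ T).linear_image
      ((ℝ ∙ d)ᗮ.orthogonalProjectionOnto : E3 →ₗ[ℝ] (ℝ ∙ d)ᗮ)
  refine ⟨⟨(ℝ ∙ d)ᗮ.starProjection '' T, hT.image _, ?_⟩, ?_, ?_⟩
  · rw [hPT]
    exact ((ℝ ∙ d)ᗮ.starProjection : E3 →ₗ[ℝ] E3).image_convexHull T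
  · have h1 : vectorSpan ℝ (shadow d P)
        = (vectorSpan ℝ P).map ((ℝ ∙ d)ᗮ.starProjection : E3 →ₗ[ℝ] E3) :=
      (AffineMap.map_vectorSpan ((ℝ ∙ d)ᗮ.starProjection : E3 →ₗ[ℝ] E3).toAffineMap).symm
    have h2 : LinearMap.range ((ℝ ∙ d)ᗮ.starProjection : E3 →ₗ[ℝ] E3) = (ℝ ∙ d)ᗮ :=
      Submodule.range_starProjection _
    rw [h1, hspan, Submodule.map_top, h2, hV]
  · rw [hshadow, extremePoints_image_of_injOn hconv _ Subtype.val_injective.injOn,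
      Set.ncard_image_of_injective _ (Submodule.subtype_injective _), hcount]
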